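/- The boxicity $\mathrm{box}(G)$ of a finite graph $G=(V,E)$ is the least integer $k\ge 0$ such that there are $k$ interval graphs on the vertex set $V$ the intersection of whose edge sets is $E$ (so complete graphs have boxicity $0$). A proper circular arc graph is a graph $G$ to whose vertices one can assign arcs of a circle such that two distinct vertices are adjacent if and only if their arcs intersect, and no arc is properly contained in another. Corollary (proper circular arc graphs). The boxicity of any proper circular arc graph can be approximated within an additive $2$ in polynomial time. That is, there is a single algorithm and a polynomial $T$ such that for every proper circular arc graph $G$ on $n$ vertices, given only by its adjacency matrix (no circular arc model is given), the algorithm halts after at most $T(n)$ steps and outputs an integer $b$ with $$\mathrm{box}(G)\le b\le \mathrm{box}(G)+2 .$$ Steps are those of a random access machine with addition and subtraction (and no multiplication) at unit cost. -/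

import Mathlib

/-! ### Interval graphs and boxicity -/

/-- `G` is an interval graph: the intersection graph of closed intervals `[l v, r v]` of the real
line (non-empty and not reduced to a point). -/
def IsIntervalGraph {V : Type*} (G : SimpleGraph V) : Prop :=
  ∃ l r : V → ℝ, (∀ v, l v < r v) ∧
    ∀ u v, G.Adj u v ↔ u ≠ v ∧ (Set.Icc (l u) (r u) ∩ Set.Icc (l v) (r v)).Nonempty

/-- `G` has a box representation of dimension `k`: it is the intersection of `k` interval graphs on
its own vertex set.  (The intersection of the empty family is the complete graph.) -/
def HasBoxRep {V : Type*} (G : SimpleGraph V) (k : ℕ) : Prop :=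
  ∃ I : Fin k → SimpleGraph V, (∀ i, IsIntervalGraph (I i)) ∧
    ∀ u v, G.Adj u v ↔ u ≠ v ∧ ∀ i, (I i).Adj u v

/-- The boxicity of `G`: the least dimension of a box representation. -/
noncomputable def boxicity {V : Type*} (G : SimpleGraph V) : ℕ :=
  sInf {k | HasBoxRep G k}

/-- Every finite graph has a box representation, so that the infimum in `boxicity` is a minimum. -/
theorem exists_hasBoxRep {V : Type*} [Finite V] (G : SimpleGraph V) : ∃ k, HasBoxRep G k := by
  classical
  let N := {e : V × V // e.1 ≠ e.2 ∧ ¬ G.Adj e.1 e.2}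
  obtain ⟨k, ⟨f⟩⟩ := Finite.exists_equiv_fin N
  let l : N → V → ℝ := fun e v => if v = e.1.2 then 2 else 0
  let r : N → V → ℝ := fun e v => if v = e.1.1 then 1 else 3
  let J : N → SimpleGraph V := fun e =>
    { Adj := fun u v => u ≠ v ∧
        (Set.Icc (l e u) (r e u) ∩ Set.Icc (l e v) (r e v)).Nonempty
      symm := ⟨fun u v h => ⟨h.1.symm, by rw [Set.inter_comm]; exact h.2⟩⟩
      loopless := ⟨fun u h => h.1 rfl⟩ }
  refine ⟨k, fun i => J (f.symm i), fun i => ⟨l (f.symm i), r (f.symm i), ?_, ?_⟩, ?_⟩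
  · intro v
    have := (f.symm i).2.1
    by_cases h1 : v = (f.symm i).1.1 <;> by_cases h2 : v = (f.symm i).1.2
    · exact absurd (h1.symm.trans h2) this
    all_goals simp only [l, r, h1, h2, if_true, if_false]; norm_num [this, Ne.symm this]
  · intro u v
    rfl
  · intro u v
    constructor
    · intro h
      refine ⟨h.ne, fun i => ⟨h.ne, ?_⟩⟩
      have h0 := (f.symm i).2.2
      generalize (f.symm i) = e at h0
      by_cases a : u = e.1.2 ∨ v = e.1.2
      · refine ⟨2, ⟨?_, ?_⟩, ?_, ?_⟩ <;> simp only [l, r] <;> split_ifs <;> norm_num <;>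
          grind [SimpleGraph.adj_comm]
      · push Not at a
        refine ⟨0, ⟨?_, ?_⟩, ?_, ?_⟩ <;> simp only [l, r] <;> split_ifs <;> norm_num <;>
          grind
    · rintro ⟨hne, h⟩
      by_contra hadj
      obtain ⟨-, x, hx⟩ := h (f ⟨(u, v), hne, hadj⟩)
      simp only [Equiv.symm_apply_apply, l, r, Set.mem_inter_iff, Set.mem_Icc, if_true, hne] at hx
      linarith [hx.1.2, hx.2.1]

/-! ### Proper circular arc graphs -/

/-- The closed arc `[s, t]` of the circle `ℝ / ℤ`, traversed from `s` to `t` in the positive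
direction.  It is only used for `s ≠ t`, when it is neither a point nor the whole circle. -/
def circArc (s t : UnitAddCircle) : Set UnitAddCircle := Set.cIcc s t

/-- `G` is a proper circular arc graph: the intersection graph of a family of arcs of a circle in
which no arc is properly contained in another. -/
def IsProperCircularArcGraph {V : Type*} (G : SimpleGraph V) : Prop :=
  ∃ s t : V → UnitAddCircle, (∀ v, s v ≠ t v) ∧
    (∀ u v, G.Adj u v ↔ u ≠ v ∧ (circArc (s u) (t u) ∩ circArc (s v) (t v)).Nonempty) ∧
    ∀ u v, ¬ circArc (s u) (t u) ⊂ circArc (s v) (t v)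

/-! ### Random access machine programs and their running time

Structured programs over finitely many registers and finitely many unbounded arrays of natural
numbers.  The arithmetic is addition and truncated subtraction only (no multiplication), each at
unit cost, so that polynomial time is the same as for Turing machines. -/

namespace RAM

/-- The memory: register `x` holds `reg x`, and cell `i` of array `a` holds `arr a i`.  A program
names only finitely many registers and arrays. -/
structure State where
  reg : ℕ → ℕ
  arr : ℕ → ℕ → ℕ

/-- Arithmetic expressions: constants, registers, array cells, sum, truncated difference. -/
inductive Expr where
  | num (c : ℕ)
  | var (x : ℕ)
  | get (a : ℕ) (i : Expr)
  | add (e₁ e₂ : Expr)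
  | sub (e₁ e₂ : Expr)

/-- The value of an expression. -/
def Expr.eval (σ : State) : Expr → ℕ
  | .num c => c
  | .var x => σ.reg x
  | .get a i => σ.arr a (i.eval σ)
  | .add e₁ e₂ => e₁.eval σ + e₂.eval σ
  | .sub e₁ e₂ => e₁.eval σ - e₂.eval σ

/-- The time for evaluating an expression: one step per operation, constant or register. -/
def Expr.cost : Expr → ℕ
  | .num _ => 1
  | .var _ => 1
  | .get _ i => i.cost + 1
  | .add e₁ e₂ => e₁.cost + e₂.cost + 1
  | .sub e₁ e₂ => e₁.cost + e₂.cost + 1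

/-- Programs. -/
inductive Prog where
  /-- do nothing -/
  | skip
  /-- store the value of `e` in register `x` -/
  | assign (x : ℕ) (e : Expr)
  /-- store the value of `e` in cell `i` of array `a` -/
  | store (a : ℕ) (i e : Expr)
  /-- run `p`, then `q` -/
  | seq (p q : Prog)
  /-- run `p` if the value of `e` is nonzero, and `q` otherwise -/
  | branch (e : Expr) (p q : Prog)
  /-- run `p` again and again as long as the value of `e` is nonzero -/
  | loop (e : Expr) (p : Prog)

/-- `Runs p σ k τ`: started in the state `σ`, the program `p` halts after exactly `k` steps in the
state `τ`. -/
inductive Runs : Prog → State → ℕ → State → Prop where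
  | skip (σ : State) : Runs .skip σ 1 σ
  | assign (σ : State) (x : ℕ) (e : Expr) :
      Runs (.assign x e) σ (e.cost + 1)
        { σ with reg := Function.update σ.reg x (e.eval σ) }
  | store (σ : State) (a : ℕ) (i e : Expr) :
      Runs (.store a i e) σ (i.cost + e.cost + 1)
        { σ with arr := Function.update σ.arr a
                          (Function.update (σ.arr a) (i.eval σ) (e.eval σ)) }
  | seq {p q : Prog} {σ τ υ : State} {j k : ℕ} :
      Runs p σ j τ → Runs q τ k υ → Runs (.seq p q) σ (j + k) υ
  | branch_true {e : Expr} {p q : Prog} {σ τ : State} {k : ℕ} :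
      e.eval σ ≠ 0 → Runs p σ k τ → Runs (.branch e p q) σ (e.cost + 1 + k) τ
  | branch_false {e : Expr} {p q : Prog} {σ τ : State} {k : ℕ} :
      e.eval σ = 0 → Runs q σ k τ → Runs (.branch e p q) σ (e.cost + 1 + k) τ
  | loop_done {e : Expr} {p : Prog} {σ : State} :
      e.eval σ = 0 → Runs (.loop e p) σ (e.cost + 1) σ
  | loop_step {e : Expr} {p : Prog} {σ τ υ : State} {j k : ℕ} :
      e.eval σ ≠ 0 → Runs p σ j τ → Runs (.loop e p) τ k υ →
      Runs (.loop e p) σ (e.cost + 1 + j + k) υ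

/-- Programs are deterministic: the running time and the final state are unique. -/
theorem Runs.deterministic {p : Prog} {σ τ τ' : State} {k k' : ℕ}
    (h : Runs p σ k τ) (h' : Runs p σ k' τ') : k = k' ∧ τ = τ' := by
  induction h generalizing k' τ' with
  | skip | assign | store => cases h'; exact ⟨rfl, rfl⟩
  | seq _ _ ih₁ ih₂ =>
    cases h' with
    | seq a b =>
      obtain ⟨rfl, rfl⟩ := ih₁ a
      obtain ⟨rfl, rfl⟩ := ih₂ b
      exact ⟨rfl, rfl⟩
  | branch_true he _ ih =>
    cases h' with
    | branch_true _ a => obtain ⟨rfl, rfl⟩ := ih a; exact ⟨rfl, rfl⟩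
    | branch_false he' _ => exact absurd he' he
  | branch_false he _ ih =>
    cases h' with
    | branch_true he' _ => exact absurd he he'
    | branch_false _ a => obtain ⟨rfl, rfl⟩ := ih a; exact ⟨rfl, rfl⟩
  | loop_done he =>
    cases h' with
    | loop_done => exact ⟨rfl, rfl⟩
    | loop_step he' => exact absurd he he'
  | loop_step he _ _ ih₁ ih₂ =>
    cases h' with
    | loop_done he' => exact absurd he' he
    | loop_step _ a b =>
      obtain ⟨rfl, rfl⟩ := ih₁ a
      obtain ⟨rfl, rfl⟩ := ih₂ b
      exact ⟨rfl, rfl⟩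

open Classical in
/-- The initial state for the input graph `G` on the vertices `0, …, n - 1`: register `0` holds `n`,
array `0` holds the adjacency matrix of `G` row by row (cell `i * n + j` is `1` if `i` and `j` are
adjacent, and `0` otherwise), and everything else is `0`. -/
noncomputable def inputState {n : ℕ} (G : SimpleGraph (Fin n)) : State where
  reg x := if x = 0 then n else 0
  arr a k := if a = 0 ∧ ∃ i j : Fin n, k = (i : ℕ) * n + (j : ℕ) ∧ G.Adj i j then 1 else 0

end RAM

/-!
Call a list of `k` non-edges of `G` a cocktail party if any two of them induce a four-cycle, and let
`ω` be the largest size of a cocktail party.  The program computes `ω + 2`, which is a correct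
answer for proper circular arc graphs because `ω ≤ boxicity G ≤ ω + 2`.

The lower bound holds for every graph: an interval graph has no induced four-cycle, so that the
non-edges of a cocktail party are missing from distinct interval graphs of a box representation
(`IsCocktailParty.length_le_boxicity`).

For the upper bound (`IsCutModel.hasBoxRep`), leave aside the vertices adjacent to all others.  Then
no two arcs cover the circle.  Let `A` be the set of arcs through a point of the circle, and `B` the
set of arcs through a point just beyond all arcs of `A`; these are disjoint cliques.  Without `A`,
as without `B`, the graph is an interval graph, and two interval graphs take care of all non-edges
except those between `A` and `B`.  The latter are partially ordered by the position of their two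
gaps, comparable ones form four-cycles, and hence there are at most `ω` antichains.  Interval
orders contain no `2 + 2`, and by this an antichain has no alternating cycle and is separated by a
single interval graph.

To compute `ω` without a model, try every non-edge `x`, `y` as a member of the cocktail party.  The
common neighbours of `x` and `y` form two cliques, and the non-edges between them can be extended to
a cocktail party greedily: there is always a *simplicial* non-edge, one for which those not joined
to it are not joined to each other (`IsCutModel.exists_isSimplicial`).  It may be taken into a
maximum cocktail party (`IsSimplicial.isMaxParty_succ`), it is found by exhaustive search in the
graph alone, and the search continues among the common neighbours of its ends.

Running times are handled by the relation `RAM.PolyTime`, total correctness within polynomial time,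
which has one rule for each program construct.
-/

/-! ### Cocktail parties -/

/-- Two non-edges `p = {p.1, p.2}` and `q = {q.1, q.2}` are joined when every end of `p` is adjacent
to every end of `q`; together they then induce a four-cycle. -/
def CrossAdj {V : Type*} (G : SimpleGraph V) (p q : V × V) : Prop :=
  G.Adj p.1 q.1 ∧ G.Adj p.1 q.2 ∧ G.Adj p.2 q.1 ∧ G.Adj p.2 q.2

/-- A cocktail party in `U`: a list of pairwise joined non-edges of `G` with ends in `U`.  A list
of length `k` is the same as an induced subgraph on `2 k` vertices whose complement is a perfect
matching. -/
def IsCocktailParty {V : Type*} (G : SimpleGraph V) (U : Set V) (L : List (V × V)) : Prop :=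
  L.Pairwise (CrossAdj G) ∧ ∀ p ∈ L, Gᶜ.Adj p.1 p.2 ∧ p.1 ∈ U ∧ p.2 ∈ U

/-- `m` is the largest number of non-edges of a cocktail party in `U`. -/
def IsMaxParty {V : Type*} (G : SimpleGraph V) (U : Set V) (m : ℕ) : Prop :=
  (∃ L, IsCocktailParty G U L ∧ L.length = m) ∧ ∀ L, IsCocktailParty G U L → L.length ≤ m

section

variable {V : Type*} {G : SimpleGraph V}

theorem CrossAdj.symm {p q : V × V} (h : CrossAdj G p q) : CrossAdj G q p :=
  ⟨h.1.symm, h.2.2.1.symm, h.2.1.symm, h.2.2.2.symm⟩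

theorem crossAdj_swap_right {p : V × V} {x y : V} : CrossAdj G p (x, y) ↔ CrossAdj G p (y, x) := by
  unfold CrossAdj; tauto

theorem isCocktailParty_nil (U : Set V) : IsCocktailParty G U [] := by
  simp [IsCocktailParty]

theorem isCocktailParty_cons {U : Set V} {x y : V} {L : List (V × V)} :
    IsCocktailParty G U ((x, y) :: L) ↔ (Gᶜ.Adj x y ∧ x ∈ U ∧ y ∈ U) ∧
      IsCocktailParty G (U ∩ {w | G.Adj x w ∧ G.Adj y w}) L := by
  simp only [IsCocktailParty, List.pairwise_cons, List.mem_cons, forall_eq_or_imp, CrossAdj,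
    Set.mem_inter_iff, Set.mem_ofPred_eq]
  constructor
  · rintro ⟨⟨h1, h2⟩, h3, h4⟩
    refine ⟨h3, h2, fun p hp => ?_⟩
    have := h1 p hp
    have := h4 p hp
    tauto
  · rintro ⟨h3, h2, h4⟩
    refine ⟨⟨fun p hp => ?_, h2⟩, h3, fun p hp => ?_⟩ <;>
    · have := h4 p hp
      tauto

/-- An interval graph has no induced four-cycle: two joined non-edges of a subgraph cannot both be
non-edges of it. -/
theorem IsIntervalGraph.adj_or_adj {I : SimpleGraph V} (hI : IsIntervalGraph I) {p q : V × V}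
    (hpq : CrossAdj I p q) (hp : p.1 ≠ p.2) (hq : q.1 ≠ q.2) : I.Adj p.1 p.2 ∨ I.Adj q.1 q.2 := by
  obtain ⟨l, r, hlr, hadj⟩ := hI
  have key : ∀ u v, (Set.Icc (l u) (r u) ∩ Set.Icc (l v) (r v)).Nonempty ↔
      l u ≤ r v ∧ l v ≤ r u := by
    intro u v
    rw [Set.Icc_inter_Icc, Set.nonempty_Icc]
    have := hlr u
    have := hlr v
    simp only [max_le_iff, le_min_iff]
    constructor
    · rintro ⟨⟨a, b⟩, c, d⟩
      exact ⟨c, b⟩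
    · rintro ⟨a, b⟩
      exact ⟨⟨by linarith, b⟩, a, by linarith⟩
  simp only [CrossAdj, hadj, key] at hpq ⊢
  obtain ⟨⟨-, a1, a2⟩, ⟨-, b1, b2⟩, ⟨-, c1, c2⟩, ⟨-, d1, d2⟩⟩ := hpq
  by_contra! hcon
  obtain ⟨h1, h2⟩ := hcon
  have h1 := h1 hp
  have h2 := h2 hq
  rcases le_or_gt (l p.1) (r p.2) with h3 | h3 <;> rcases le_or_gt (l q.1) (r q.2) with h4 | h4
  · linarith [h1 h3, h2 h4]
  · linarith [h1 h3]
  · linarith [h2 h4]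
  · linarith

/-- Distinct non-edges of a cocktail party need distinct interval graphs. -/
theorem IsCocktailParty.length_le_of_hasBoxRep {U : Set V} {L : List (V × V)}
    (hL : IsCocktailParty G U L) {k : ℕ} (hk : HasBoxRep G k) : L.length ≤ k := by
  obtain ⟨I, hI, hadj⟩ := hk
  have hex : ∀ j : Fin L.length, ∃ i, ¬ (I i).Adj L[j].1 L[j].2 := by
    intro j
    have h := (hL.2 L[j] (List.getElem_mem _)).1
    rw [SimpleGraph.compl_adj, hadj] at h
    by_contra! hcon
    exact h.2 ⟨h.1, hcon⟩
  choose f hf using hex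
  have hlt : ∀ i j : Fin L.length, i < j → f i ≠ f j := by
    intro i j hij hfij
    have hJ : CrossAdj G L[i] L[j] := List.pairwise_iff_getElem.1 hL.1 i j i.2 j.2 hij
    have hJ' : CrossAdj (I (f i)) L[i] L[j] := by
      simp only [CrossAdj, hadj] at hJ ⊢
      exact ⟨hJ.1.2 _, hJ.2.1.2 _, hJ.2.2.1.2 _, hJ.2.2.2.2 _⟩
    rcases (hI (f i)).adj_or_adj hJ' (hL.2 L[i] (List.getElem_mem _)).1.ne
      (hL.2 L[j] (List.getElem_mem _)).1.ne with h | h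
    · exact hf i h
    · exact hf j (hfij ▸ h)
  have hinj : Function.Injective f := by
    intro i j hij
    by_contra hne
    rcases lt_or_gt_of_ne hne with h | h
    · exact hlt i j h hij
    · exact hlt j i h hij.symm
  simpa using Fintype.card_le_of_injective f hinj

theorem IsCocktailParty.length_le_boxicity [Finite V] {U : Set V} {L : List (V × V)}
    (hL : IsCocktailParty G U L) : L.length ≤ boxicity G :=
  hL.length_le_of_hasBoxRep (Nat.sInf_mem (exists_hasBoxRep G))

/-! ### The greedy step -/

/-- The non-edge `p` is simplicial in `U` when those non-edges in `U` that are not joined to `p` are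
not joined to each other either. -/
def IsSimplicial (G : SimpleGraph V) (U : Set V) (p : V × V) : Prop :=
  ∀ q q' : V × V, q.1 ∈ U → q.2 ∈ U → Gᶜ.Adj q.1 q.2 → q'.1 ∈ U → q'.2 ∈ U → Gᶜ.Adj q'.1 q'.2 →
    ¬ CrossAdj G p q → ¬ CrossAdj G p q' → ¬ CrossAdj G q q'

/-- A simplicial non-edge can be put into a maximum cocktail party: any cocktail party has at most
one non-edge that is not joined to it. -/
theorem IsSimplicial.isMaxParty_succ {U : Set V} {x y : V} {m : ℕ} (h : IsSimplicial G U (x, y))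
    (hxy : Gᶜ.Adj x y) (hx : x ∈ U) (hy : y ∈ U)
    (hm : IsMaxParty G (U ∩ {w | G.Adj x w ∧ G.Adj y w}) m) : IsMaxParty G U (m + 1) := by
  classical
  obtain ⟨⟨L, hL, rfl⟩, hmax⟩ := hm
  refine ⟨⟨(x, y) :: L, isCocktailParty_cons.2 ⟨⟨hxy, hx, hy⟩, hL⟩, rfl⟩, fun M hM => ?_⟩
  rw [List.length_eq_length_filter_add (fun q => decide (CrossAdj G (x, y) q))]
  gcongr
  · apply hmax
    refine ⟨hM.1.filter _, fun p hp => ?_⟩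
    simp only [List.mem_filter, decide_eq_true_eq] at hp
    obtain ⟨h1, h2, h3⟩ := hM.2 p hp.1
    obtain ⟨h4, h5, h6, h7⟩ := hp.2
    exact ⟨h1, ⟨h2, h4, h6⟩, h3, h5, h7⟩
  · have hpw := hM.1.filter (fun q => !decide (CrossAdj G (x, y) q))
    have hmem : ∀ q ∈ M.filter (fun q => !decide (CrossAdj G (x, y) q)),
        q ∈ M ∧ ¬ CrossAdj G (x, y) q := by simp
    generalize M.filter (fun q => !decide (CrossAdj G (x, y) q)) = K at hpw hmem
    rcases K with _ | ⟨q, _ | ⟨q', K⟩⟩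
    · simp
    · simp
    · obtain ⟨hq, hq1⟩ := hmem q (by simp)
      obtain ⟨hq', hq1'⟩ := hmem q' (by simp)
      have a := hM.2 q hq
      have a' := hM.2 q' hq'
      exact absurd (List.rel_of_pairwise_cons hpw (by simp))
        (h q q' a.2.1 a.2.2 a.1 a'.2.1 a'.2.2 a'.1 hq1 hq1')

theorem isMaxParty_zero {U : Set V} (h : ∀ x ∈ U, ∀ y ∈ U, ¬ Gᶜ.Adj x y) : IsMaxParty G U 0 := by
  refine ⟨⟨[], isCocktailParty_nil U, rfl⟩, fun L hL => ?_⟩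
  rcases L with _ | ⟨⟨x, y⟩, L⟩
  · simp
  · obtain ⟨⟨h1, h2, h3⟩, -⟩ := isCocktailParty_cons.1 hL
    exact absurd h1 (h x h2 y h3)

end

/-! ### Cutting the circle -/

/-- A proper circular arc model, cut open at a point of the circle: the vertex `v` is represented
by the arc that is the image of `[l v, r v]` in `ℝ / ℤ`, where `0 ≤ l v < 1` and
`l v < r v < l v + 1`.  Two arcs meet if and only if the intervals meet up to a shift by `1`, and
the last two fields say that no arc is properly contained in another. -/
structure IsCutModel {V : Type*} (G : SimpleGraph V) (l r : V → ℝ) : Prop where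
  nonneg : ∀ v, 0 ≤ l v
  lt_one : ∀ v, l v < 1
  lt : ∀ v, l v < r v
  lt_add : ∀ v, r v < l v + 1
  adj : ∀ u v, G.Adj u v ↔ u ≠ v ∧ ((l u ≤ r v ∧ l v ≤ r u) ∨ l u + 1 ≤ r v ∨ l v + 1 ≤ r u)
  proper : ∀ u v, l v ≤ l u → r u ≤ r v → l u = l v ∧ r u = r v
  proper_shift : ∀ u v, r v < r u + 1

section

local instance : Fact ((0 : ℝ) < 1) := ⟨one_pos⟩

theorem UnitAddCircle.coe_eq_coe_iff {x y : ℝ} :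
    (x : UnitAddCircle) = (y : UnitAddCircle) ↔ ∃ m : ℤ, x = y + m := by
  rw [← sub_eq_zero, ← AddCircle.coe_sub, AddCircle.coe_eq_zero_iff]
  constructor <;> rintro ⟨m, hm⟩ <;> refine ⟨m, ?_⟩ <;> simp at * <;> linarith

theorem circArc_coe {a b : ℝ} (hab : a < b) (hba : b < a + 1) :
    circArc (a : UnitAddCircle) (b : UnitAddCircle) =
      {z | ∃ x : ℝ, (x : UnitAddCircle) = z ∧ a ≤ x ∧ x ≤ b} := by
  ext z
  induction z using QuotientAddGroup.induction_on with
  | H z =>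
    have h1 : toIocMod (one_pos : (0 : ℝ) < 1) a b = b :=
      (toIocMod_eq_self _).2 ⟨hab, hba.le⟩
    rw [circArc, Set.mem_cIcc]
    refine QuotientAddGroup.btw_coe_iff.trans ?_
    rw [h1]
    have h2 := toIcoMod_mem_Ico (one_pos : (0 : ℝ) < 1) a z
    constructor
    · intro h
      refine ⟨_, ?_, h2.1, h⟩
      refine UnitAddCircle.coe_eq_coe_iff.2 ⟨-toIcoDiv one_pos a z, ?_⟩
      have := toIcoMod_add_toIcoDiv_zsmul (one_pos : (0 : ℝ) < 1) a z
      simp at this ⊢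
      linarith
    · rintro ⟨x, hxz, hax, hxb⟩
      obtain ⟨m, hm⟩ := UnitAddCircle.coe_eq_coe_iff.1 hxz
      have : toIcoMod (one_pos : (0 : ℝ) < 1) a z = x := by
        rw [toIcoMod_eq_iff]
        exact ⟨⟨hax, by linarith⟩, -m, by simp; linarith⟩
      rw [this]
      exact hxb

/-- Every point of the circle has a lift in `[c, c + 1)`. -/
theorem UnitAddCircle.exists_lift (c : ℝ) (z : UnitAddCircle) :
    ∃ x : ℝ, (x : UnitAddCircle) = z ∧ c ≤ x ∧ x < c + 1 := by
  refine ⟨(AddCircle.equivIco 1 c z : ℝ), AddCircle.coe_equivIco, ?_⟩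
  exact (AddCircle.equivIco 1 c z).2

/-- The circle may be cut at the starting point of any chosen arc. -/
theorem IsProperCircularArcGraph.exists_isCutModel {V : Type*} {G : SimpleGraph V}
    (hG : IsProperCircularArcGraph G) (x₀ : V) : ∃ l r : V → ℝ, l x₀ = 0 ∧ IsCutModel G l r := by
  obtain ⟨s, t, hst, hadj, hprop⟩ := hG
  obtain ⟨c, hc⟩ : ∃ c : ℝ, (c : UnitAddCircle) = s x₀ := by
    obtain ⟨c, hc, -⟩ := UnitAddCircle.exists_lift 0 (s x₀)
    exact ⟨c, hc⟩
  choose l hl hl0 hl1 using fun v => UnitAddCircle.exists_lift c (s v)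
  choose r hr hr0 hr1 using fun v => UnitAddCircle.exists_lift (l v) (t v)
  have hlt : ∀ v, l v < r v := by
    intro v
    refine lt_of_le_of_ne (hr0 v) fun h => hst v ?_
    rw [← hl, ← hr, h]
  have harc : ∀ v, circArc (s v) (t v) =
      {z | ∃ x : ℝ, (x : UnitAddCircle) = z ∧ l v ≤ x ∧ x ≤ r v} := by
    intro v
    rw [← hl, ← hr, circArc_coe (hlt v) (hr1 v)]
  have hcap : ∀ u v, (circArc (s u) (t u) ∩ circArc (s v) (t v)).Nonempty ↔
      ∃ m : ℤ, l u ≤ r v + m ∧ l v + m ≤ r u := by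
    intro u v
    rw [harc, harc]
    constructor
    · rintro ⟨z, ⟨x, rfl, hx⟩, y, hy, hy'⟩
      obtain ⟨m, hm⟩ := UnitAddCircle.coe_eq_coe_iff.1 hy.symm
      exact ⟨m, by linarith, by linarith⟩
    · rintro ⟨m, h1, h2⟩
      refine ⟨((max (l u) (l v + m) : ℝ) : UnitAddCircle), ⟨_, rfl, le_max_left _ _, ?_⟩,
        max (l u) (l v + m) - m, ?_, ?_, ?_⟩
      · exact max_le (hlt u).le h2
      · exact UnitAddCircle.coe_eq_coe_iff.2 ⟨-m, by simp; ring⟩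
      · linarith [le_max_right (l u) (l v + m)]
      · rw [sub_le_iff_le_add]
        exact max_le h1 (by linarith [hlt v])
  have hp : ∀ u v (m : ℤ), l v ≤ l u + m → r u + m ≤ r v → l u + m = l v ∧ r u + m = r v := by
    intro u v m h1 h2
    by_contra hne
    refine hprop u v ⟨?_, fun hsub => hne ?_⟩
    · rw [harc, harc]
      rintro z ⟨x, rfl, hx⟩
      exact ⟨x + m, UnitAddCircle.coe_eq_coe_iff.2 ⟨m, rfl⟩, by linarith, by linarith⟩
    · rw [harc, harc] at hsub
      have hv := hr1 v
      constructor
      · obtain ⟨y, hy, hy1, hy2⟩ := hsub ⟨l v, rfl, le_rfl, (hlt v).le⟩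
        obtain ⟨k, hk⟩ := UnitAddCircle.coe_eq_coe_iff.1 hy
        have : m + k < 1 := by
          have : ((m + k : ℤ) : ℝ) < 1 := by push_cast; linarith
          exact_mod_cast this
        have : (m : ℝ) + k ≤ 0 := by exact_mod_cast Int.lt_add_one_iff.1 this
        linarith
      · obtain ⟨y, hy, hy1, hy2⟩ := hsub ⟨r v, rfl, (hlt v).le, le_rfl⟩
        obtain ⟨k, hk⟩ := UnitAddCircle.coe_eq_coe_iff.1 hy
        have : -1 < m + k := by
          have : (-1 : ℝ) < ((m + k : ℤ) : ℝ) := by push_cast; linarith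
          exact_mod_cast this
        have : (0 : ℝ) ≤ m + k := by exact_mod_cast Int.add_one_le_of_lt this
        linarith
  have hx₀ : l x₀ = c := by
    obtain ⟨m, hm⟩ := UnitAddCircle.coe_eq_coe_iff.1 ((hl x₀).trans hc.symm)
    have h0 := hl0 x₀
    have h1 := hl1 x₀
    have h2 : m < 1 := by
      have : (m : ℝ) < 1 := by linarith
      exact_mod_cast this
    have h3 : 0 ≤ m := by
      have : (0 : ℝ) ≤ m := by linarith
      exact_mod_cast this
    have : m = 0 := by omega
    rw [hm, this]
    simp
  refine ⟨fun v => l v - c, fun v => r v - c, by simp [hx₀], ?_, ?_, ?_, ?_, ?_, ?_, ?_⟩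
  · intro v; linarith [hl0 v]
  · intro v; linarith [hl1 v]
  · intro v; linarith [hlt v]
  · intro v; linarith [hr1 v]
  · intro u v
    rw [hadj, hcap]
    refine and_congr_right fun _ => ⟨?_, ?_⟩
    · rintro ⟨m, h1, h2⟩
      have a := hl0 u
      have a' := hl1 u
      have b := hl0 v
      have b' := hl1 v
      have e := hr1 u
      have e' := hr1 v
      have h3 : m < 2 := by
        have : (m : ℝ) < 2 := by linarith
        exact_mod_cast this
      have h4 : -2 < m := by
        have : (-2 : ℝ) < m := by linarith
        exact_mod_cast this
      obtain rfl | rfl | rfl : m = -1 ∨ m = 0 ∨ m = 1 := by omega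
      · right; left; push_cast at h1; linarith
      · left; push_cast at h1 h2; constructor <;> linarith
      · right; right; push_cast at h2; linarith
    · have a := hl0 u
      have a' := hl1 u
      have b := hl0 v
      have b' := hl1 v
      have e := hlt u
      have e' := hlt v
      rintro (⟨h1, h2⟩ | h | h)
      · exact ⟨0, by push_cast; linarith, by push_cast; linarith⟩
      · exact ⟨-1, by push_cast; linarith, by push_cast; linarith⟩
      · exact ⟨1, by push_cast; linarith, by push_cast; linarith⟩
  · intro u v h1 h2
    have := hp u v 0 (by push_cast; linarith) (by push_cast; linarith)
    push_cast at this
    exact ⟨by linarith, by linarith⟩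
  · intro u v
    by_contra! h
    have := hp u v 1 (by push_cast; linarith [hl0 u, hl1 v]) (by push_cast; linarith)
    push_cast at this
    linarith [hl0 u, hl1 v]

end

/-! ### Simplicial non-edges between two disjoint arcs -/

section

variable {V : Type*} {G : SimpleGraph V} {l r : V → ℝ}

theorem IsCutModel.mono (h : IsCutModel G l r) {u v : V} (huv : l u ≤ l v) : r u ≤ r v := by
  by_contra! hlt
  have := (h.proper v u huv hlt.le).2
  linarith

/-- The common neighbours of two disjoint arcs `x`, `y` fall into two cliques, according to the gap
between `x` and `y` that they cover.  The arcs of each clique are linearly ordered by their starting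
points.  Among the non-edges of `U`, first take the least possible end in the first clique, then
the least possible end in the second one: the resulting non-edge is simplicial. -/
theorem IsCutModel.exists_isSimplicial [Finite V] (h : IsCutModel G l r) {x y : V} (hx : l x = 0)
    (hxy : Gᶜ.Adj x y) {U : Set V} (hU : ∀ w ∈ U, G.Adj x w ∧ G.Adj y w) {a b : V} (ha : a ∈ U)
    (hb : b ∈ U) (hab : Gᶜ.Adj a b) :
    ∃ u ∈ U, ∃ v ∈ U, Gᶜ.Adj u v ∧ IsSimplicial G U (u, v) := by
  have hx1 := h.lt_add x
  have hy0 := h.lt y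
  have hy2 := h.nonneg y
  have hxy' : r x < l y ∧ r y < 1 := by
    rw [SimpleGraph.compl_adj, h.adj] at hxy
    obtain ⟨hne, hnot⟩ := hxy
    by_contra hcon
    refine hnot ⟨hne, ?_⟩
    by_cases h1 : r x < l y
    · right; left; rw [hx]; by_contra! h2; exact hcon ⟨h1, by linarith⟩
    · left; constructor <;> linarith
  obtain ⟨hrx, hry⟩ := hxy'
  -- the two cliques
  have hW1 : ∀ w ∈ U, l w ≤ r x → l y ≤ r w ∧ r w < r y := by
    intro w hw hlw
    obtain ⟨-, h2⟩ := hU w hw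
    rw [h.adj] at h2
    have h3 : l y ≤ r w := by
      rcases h2.2 with h2 | h2 | h2
      · exact h2.1
      · linarith
      · linarith [h.nonneg w]
    refine ⟨h3, ?_⟩
    by_contra! h4
    have := (h.proper y w (by linarith) h4).1
    linarith
  have hW2 : ∀ w ∈ U, r x < l w → 1 ≤ r w ∧ l w ≤ r y := by
    intro w hw hlw
    obtain ⟨h1, h2⟩ := hU w hw
    rw [h.adj] at h1 h2
    have h3 : 1 ≤ r w := by
      rcases h1.2 with h1 | h1 | h1
      · linarith
      · linarith
      · linarith [h.nonneg w]
    refine ⟨h3, ?_⟩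
    have := h.proper_shift x w
    rcases h2.2 with h2 | h2 | h2
    · exact h2.2
    · linarith
    · linarith [h.nonneg w]
  have hadj1 : ∀ u ∈ U, ∀ v ∈ U, l u ≤ r x → l v ≤ r x → ¬ Gᶜ.Adj u v := by
    intro u hu v hv h1 h2 h3
    rw [SimpleGraph.compl_adj, h.adj] at h3
    obtain ⟨h4, -⟩ := hW1 u hu h1
    obtain ⟨h5, -⟩ := hW1 v hv h2
    exact h3.2 ⟨h3.1, Or.inl ⟨by linarith, by linarith⟩⟩
  have hadj2 : ∀ u ∈ U, ∀ v ∈ U, r x < l u → r x < l v → ¬ Gᶜ.Adj u v := by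
    intro u hu v hv h1 h2 h3
    rw [SimpleGraph.compl_adj, h.adj] at h3
    obtain ⟨h4, h4'⟩ := hW2 u hu h1
    obtain ⟨h5, h5'⟩ := hW2 v hv h2
    exact h3.2 ⟨h3.1, Or.inl ⟨by linarith, by linarith⟩⟩
  have hadj12 : ∀ u ∈ U, ∀ v ∈ U, l u ≤ r x → r x < l v →
      (Gᶜ.Adj u v ↔ r u < l v ∧ r v < l u + 1) := by
    intro u hu v hv h1 h2
    obtain ⟨h4, h4'⟩ := hW1 u hu h1
    obtain ⟨h5, h5'⟩ := hW2 v hv h2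
    rw [SimpleGraph.compl_adj, h.adj]
    constructor
    · rintro ⟨h6, h7⟩
      by_contra hcon
      refine h7 ⟨h6, ?_⟩
      by_cases h8 : r u < l v
      · right; left; by_contra! h9; exact hcon ⟨h8, by linarith⟩
      · left; constructor <;> linarith
    · rintro ⟨h6, h7⟩
      refine ⟨by rintro rfl; linarith, ?_⟩
      rintro ⟨-, h8 | h8 | h8⟩ <;> linarith
  clear hW1 hW2
  have hsplit : ∀ u ∈ U, ∀ v ∈ U, Gᶜ.Adj u v →
      (l u ≤ r x ∧ r x < l v) ∨ (r x < l u ∧ l v ≤ r x) := by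
    intro u hu v hv huv
    rcases le_or_gt (l u) (r x) with h1 | h1 <;> rcases le_or_gt (l v) (r x) with h2 | h2
    · exact absurd huv (hadj1 u hu v hv h1 h2)
    · exact Or.inl ⟨h1, h2⟩
    · exact Or.inr ⟨h1, h2⟩
    · exact absurd huv (hadj2 u hu v hv h1 h2)
  -- the extremal non-edge
  obtain ⟨u, ⟨huU, hu1, v₀, hv₀U, hv₀1, huv₀⟩, humin⟩ := Set.exists_min_image
    {u | u ∈ U ∧ l u ≤ r x ∧ ∃ v ∈ U, r x < l v ∧ Gᶜ.Adj u v} l (Set.toFinite _) (by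
      rcases hsplit a ha b hb hab with ⟨h1, h2⟩ | ⟨h1, h2⟩
      · exact ⟨a, ha, h1, b, hb, h2, hab⟩
      · exact ⟨b, hb, h2, a, ha, h1, hab.symm⟩)
  obtain ⟨v, ⟨hvU, hv1, huv⟩, hvmin⟩ := Set.exists_min_image
    {v | v ∈ U ∧ r x < l v ∧ Gᶜ.Adj u v} l (Set.toFinite _) ⟨v₀, hv₀U, hv₀1, huv₀⟩
  refine ⟨u, huU, v, hvU, huv, ?_⟩
  have hue := (hadj12 u huU v hvU hu1 hv1).1 huv
  have hmin : ∀ u' ∈ U, ∀ v' ∈ U, l u' ≤ r x → r x < l v' → Gᶜ.Adj u' v' →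
      l u ≤ l u' ∧ l v ≤ l v' := by
    intro u' hu' v' hv' h1 h2 h3
    have h4 : l u ≤ l u' := humin u' ⟨hu', h1, v', hv', h2, h3⟩
    refine ⟨h4, ?_⟩
    by_contra! h5
    have h6 := (hadj12 u' hu' v' hv' h1 h2).1 h3
    have h7 := h.mono h4
    have h8 := h.mono h5.le
    have := hvmin v' ⟨hv', h2, (hadj12 u huU v' hv' hu1 h2).2 ⟨by linarith, by linarith⟩⟩
    linarith
  have hcross : ∀ p q : V × V, CrossAdj G p q → ¬ Gᶜ.Adj p.1 q.2 ∧ ¬ Gᶜ.Adj q.1 p.2 :=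
    fun p q hpq => ⟨fun h' => ((SimpleGraph.compl_adj ..).1 h').2 hpq.2.1,
      fun h' => ((SimpleGraph.compl_adj ..).1 h').2 hpq.2.2.1.symm⟩
  -- the claim for non-edges whose first end is in the first clique
  have key : ∀ q q' : V × V, q.1 ∈ U → q.2 ∈ U → Gᶜ.Adj q.1 q.2 → q'.1 ∈ U → q'.2 ∈ U →
      Gᶜ.Adj q'.1 q'.2 → l q.1 ≤ r x → r x < l q.2 → l q'.1 ≤ r x → r x < l q'.2 →
      ¬ CrossAdj G (u, v) q → ¬ CrossAdj G (u, v) q' → ¬ CrossAdj G q q' := by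
    rintro ⟨s, t⟩ ⟨s', t'⟩ hs ht hst hs' ht' hst' h1 h2 h1' h2' hq hq' hqq'
    dsimp only at *
    obtain ⟨h3, h4⟩ := hcross _ _ hqq'
    have hne : ∀ s ∈ U, ∀ t ∈ U, l s ≤ r x → r x < l t → ¬ CrossAdj G (u, v) (s, t) →
        (r s < l v ∧ r v < l s + 1) ∨ (r u < l t ∧ r t < l u + 1) := by
      intro s hs t ht h1 h2 hn
      rw [← hadj12 s hs v hvU h1 hv1, ← hadj12 u huU t ht hu1 h2]
      by_contra! hcon
      have e1 : ∀ s t, s ≠ t → ¬ Gᶜ.Adj s t → G.Adj s t := by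
        intro s t hst hh
        by_contra hh'
        exact hh ((SimpleGraph.compl_adj ..).2 ⟨hst, hh'⟩)
      have n1 : u ≠ t := by rintro rfl; linarith
      have n2 : v ≠ s := by rintro rfl; linarith
      have n3 : u ≠ s := by
        rintro rfl
        exact hcon.1 huv
      have n4 : v ≠ t := by
        rintro rfl
        exact hcon.2 huv
      exact hn ⟨e1 u s n3 (hadj1 u huU s hs hu1 h1), e1 u t n1 hcon.2,
        e1 v s n2 fun h' => hcon.1 h'.symm, e1 v t n4 (hadj2 v hvU t ht hv1 h2)⟩
    have e := (hadj12 s hs t ht h1 h2).1 hst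
    have e' := (hadj12 s' hs' t' ht' h1' h2').1 hst'
    obtain ⟨m1, m2⟩ := hmin s hs t ht h1 h2 hst
    obtain ⟨m1', m2'⟩ := hmin s' hs' t' ht' h1' h2' hst'
    rw [hadj12 s hs t' ht' h1 h2'] at h3
    rw [hadj12 s' hs' t ht h1' h2] at h4
    rcases hne s hs t ht h1 h2 hq with k | k <;> rcases hne s' hs' t' ht' h1' h2' hq' with k' | k'
    · rcases le_total (l s) (l s') with c | c
      · exact h4 ⟨by linarith, by linarith⟩
      · exact h3 ⟨by linarith, by linarith⟩
    · exact h3 ⟨by linarith, by linarith⟩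
    · exact h4 ⟨by linarith, by linarith⟩
    · rcases le_total (l t) (l t') with c | c
      · exact h3 ⟨by linarith, by linarith⟩
      · exact h4 ⟨by linarith, by linarith⟩
  -- a non-edge may be listed with its ends in either order
  have key' : ∀ q q' : V × V, q.1 ∈ U → q.2 ∈ U → Gᶜ.Adj q.1 q.2 → q'.1 ∈ U → q'.2 ∈ U →
      Gᶜ.Adj q'.1 q'.2 → l q.1 ≤ r x → r x < l q.2 →
      ¬ CrossAdj G (u, v) q → ¬ CrossAdj G (u, v) q' → ¬ CrossAdj G q q' := by
    intro q q' hs ht hst hs' ht' hst' h1 h2 hq hq'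
    rcases hsplit _ hs' _ ht' hst' with c | c
    · exact key q q' hs ht hst hs' ht' hst' h1 h2 c.1 c.2 hq hq'
    · rw [crossAdj_swap_right (x := q'.1) (y := q'.2)] at hq' ⊢
      exact key q (q'.2, q'.1) hs ht hst ht' hs' hst'.symm h1 h2 c.2 c.1 hq hq'
  intro q q' hs ht hst hs' ht' hst' hq hq'
  rcases hsplit _ hs _ ht hst with c | c
  · exact key' q q' hs ht hst hs' ht' hst' c.1 c.2 hq hq'
  · intro hqq'
    rw [crossAdj_swap_right (x := q.1) (y := q.2)] at hq
    exact key' (q.2, q.1) q' ht hs hst.symm hs' ht' hst' c.2 c.1 hq hq'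
      (crossAdj_swap_right.1 hqq'.symm).symm

end

/-! ### Interval graphs from endpoints -/

section

variable {V : Type*} {G : SimpleGraph V}

/-- A box representation given by the endpoints `f i v < g i v` of its intervals. -/
theorem hasBoxRep_of_endpoints {ι : Type*} [Fintype ι] (f g : ι → V → ℝ)
    (hfg : ∀ i v, f i v < g i v)
    (hadj : ∀ u v, u ≠ v → (G.Adj u v ↔ ∀ i, f i u ≤ g i v ∧ f i v ≤ g i u)) :
    HasBoxRep G (Fintype.card ι) := by
  let e := (Fintype.equivFin ι).symm
  let J : ι → SimpleGraph V := fun i =>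
    { Adj := fun u v => u ≠ v ∧ (Set.Icc (f i u) (g i u) ∩ Set.Icc (f i v) (g i v)).Nonempty
      symm := ⟨fun u v h => ⟨h.1.symm, by rw [Set.inter_comm]; exact h.2⟩⟩
      loopless := ⟨fun u h => h.1 rfl⟩ }
  have hJ : ∀ i u v, (J i).Adj u v ↔ u ≠ v ∧ f i u ≤ g i v ∧ f i v ≤ g i u := by
    intro i u v
    refine and_congr_right fun _ => ?_
    rw [Set.Icc_inter_Icc, Set.nonempty_Icc, max_le_iff, le_min_iff, le_min_iff]
    have := hfg i u
    have := hfg i v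
    constructor
    · rintro ⟨⟨-, a⟩, b, -⟩
      exact ⟨a, b⟩
    · rintro ⟨a, b⟩
      exact ⟨⟨by linarith, a⟩, b, by linarith⟩
  refine ⟨fun i => J (e i), fun i => ⟨f (e i), g (e i), hfg _, fun u v => Iff.rfl⟩, fun u v => ?_⟩
  simp only [hJ]
  by_cases huv : u = v
  · subst huv
    simp
  · rw [hadj u v huv, e.forall_congr_left]
    simp [huv]

end

/-! ### Chains and antichains -/

/-- If every chain of `E` has at most `k` elements, then `E` splits into `k` antichains. -/
theorem exists_antichain_coloring {α : Type*} (E : Set α) (R : α → α → Prop)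
    (hR : ∀ a ∈ E, ∀ b ∈ E, ∀ c ∈ E, R a b → R b c → R a c) (k : ℕ)
    (hk : ∀ L : List α, L.Pairwise R → (∀ e ∈ L, e ∈ E) → L.length ≤ k) :
    ∃ c : α → ℕ, (∀ e ∈ E, c e < k) ∧ ∀ e ∈ E, ∀ e' ∈ E, R e e' → c e ≠ c e' := by
  classical
  -- the colour of `e` is the largest number of elements of a chain above `e`
  let P : α → ℕ → Prop := fun e m => ∃ L : List α, (e :: L).Pairwise R ∧ (∀ a ∈ L, a ∈ E) ∧
    L.length = m
  have hP : ∀ e ∈ E, ∀ m, P e m → m + 1 ≤ k := by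
    rintro e he m ⟨L, h1, h2, rfl⟩
    simpa using hk (e :: L) h1 (by simpa using ⟨he, h2⟩)
  have hP0 : ∀ e, P e 0 := fun e => ⟨[], by simp⟩
  have hspec : ∀ e, P e (Nat.findGreatest (P e) k) := fun e =>
    Nat.findGreatest_spec (P := P e) (Nat.zero_le k) (hP0 e)
  refine ⟨fun e => Nat.findGreatest (P e) k, fun e he => hP e he _ (hspec e), ?_⟩
  intro e he e' he' hee'
  obtain ⟨L, h1, h2, h3⟩ := hspec e'
  have : P e (Nat.findGreatest (P e') k + 1) := by
    refine ⟨e' :: L, ?_, by simpa using ⟨he', h2⟩, by simp [h3]⟩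
    refine List.pairwise_cons.2 ⟨fun a ha => ?_, h1⟩
    rcases List.mem_cons.1 ha with rfl | ha
    · exact hee'
    · exact hR e he e' he' a (h2 a ha) hee' (List.rel_of_pairwise_cons h1 ha)
  have hle := Nat.le_findGreatest (P := P e) (Nat.le_of_succ_le (hP e he _ this)) this
  dsimp only
  omega

/-- A relation on a finite set in which every non-empty subset has an element without predecessor
has a rank function. -/
theorem exists_rank {α : Type*} (R : α → α → Prop) (F : Finset α)
    (h : ∀ F' ⊆ F, F'.Nonempty → ∃ e ∈ F', ∀ e' ∈ F', ¬ R e' e) :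
    ∃ ρ : α → ℕ, ∀ e ∈ F, ∀ e' ∈ F, R e e' → ρ e < ρ e' := by
  classical
  induction F using Finset.strongInduction with
  | H F ih =>
    rcases F.eq_empty_or_nonempty with rfl | hF
    · exact ⟨fun _ => 0, by simp⟩
    · obtain ⟨e₀, he₀, hmin⟩ := h F subset_rfl hF
      obtain ⟨ρ, hρ⟩ := ih (F.erase e₀) (Finset.erase_ssubset he₀)
        fun F' hF' => h F' (hF'.trans (Finset.erase_subset _ _))
      refine ⟨fun e => if e = e₀ then 0 else ρ e + 1, fun e he e' he' hee' => ?_⟩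
      have h1 : e' ≠ e₀ := by
        rintro rfl
        exact hmin e he hee'
      by_cases h2 : e = e₀
      · simp [h1, h2]
      · simpa [h1, h2] using
          hρ e (Finset.mem_erase.2 ⟨h2, he⟩) e' (Finset.mem_erase.2 ⟨h1, he'⟩) hee'

/-- Thresholds from a rank function: if the set `F` of pairs has a rank function increasing along
the relation "`(a', b)` is not to be separated", where `a'` comes from the later pair and `b` from
the earlier one, then all pairs of `F` can be separated by `f a < g b` at the same time. -/
theorem exists_thresholds {α β : Type*} (F : Finset (α × β)) (S : α → β → Prop)
    (ρ : α × β → ℕ) (hρ : ∀ e ∈ F, ∀ e' ∈ F, S e'.1 e.2 → ρ e < ρ e') :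
    ∃ (f : α → ℕ) (g : β → ℕ) (K : ℕ), (∀ b, g b ≤ K) ∧
      (∀ e ∈ F, f e.1 < g e.2) ∧ ∀ a b, S a b → g b ≤ f a := by
  classical
  let K := F.sup ρ + 1
  have hK : ∀ e ∈ F, ρ e + 1 ≤ K := fun e he => Nat.succ_le_succ (Finset.le_sup (f := ρ) he)
  -- `f a` is the least rank of a pair at `a`, and `g b` exceeds the largest rank at `b` by one
  let f : α → ℕ := fun a => sInf (insert K {m | ∃ e ∈ F, e.1 = a ∧ ρ e = m})
  let g : β → ℕ := fun b => (F.filter fun e => e.2 = b).sup fun e => ρ e + 1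
  refine ⟨f, g, K, fun b => ?_, fun e he => ?_, fun a b hab => ?_⟩
  · exact Finset.sup_le fun e he => hK e (Finset.mem_filter.1 he).1
  · have h1 : f e.1 ≤ ρ e := Nat.sInf_le (Or.inr ⟨e, he, rfl, rfl⟩)
    have h2 : ρ e + 1 ≤ g e.2 := Finset.le_sup (f := fun e => ρ e + 1)
      (Finset.mem_filter.2 ⟨he, rfl⟩)
    omega
  · refine Finset.sup_le fun e he => ?_
    obtain ⟨heF, rfl⟩ := Finset.mem_filter.1 he
    refine le_csInf ⟨K, by simp⟩ ?_
    rintro m (rfl | ⟨e', he', rfl, rfl⟩)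
    · exact hK e heF
    · exact hρ e heF e' he' hab

/-! ### The upper bound -/

section

variable {V : Type*} {G : SimpleGraph V} {l r : V → ℝ}

/-- An arc `a` that is disjoint from some other arc does not cover the circle together with any
arc: the other arc would lie properly inside. -/
theorem IsCutModel.not_cover (h : IsCutModel G l r) {a b w : V} (haw : Gᶜ.Adj a w)
    (ha : 1 ≤ r a) (hb : 1 ≤ r b) : r a - 1 < l b := by
  by_contra! hcon
  rw [SimpleGraph.compl_adj, h.adj] at haw
  obtain ⟨hne, hn⟩ := haw
  have h1 := h.lt_one w
  have h2 : r w < l a := by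
    by_contra! h3
    exact hn ⟨hne, Or.inl ⟨h3, by linarith⟩⟩
  have h3 : r a < l w + 1 := by
    by_contra! h3
    exact hn ⟨hne, Or.inr (Or.inr h3)⟩
  have := h.lt_one a
  have := h.proper w b (by linarith) (by linarith)
  linarith

/-- The order of the non-edges `(a, b)` between two cliques: `e` precedes `e'` if `e'` lies beyond
`e` on both sides of the circle. -/
def Precedes (l r : V → ℝ) (e e' : V × V) : Prop :=
  l e.2 + 1 ≤ r e'.1 ∧ l e.1 ≤ r e'.2

/-- A proper circular arc graph whose cocktail parties have at most `k` non-edges has boxicity at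
most `k + 2`.  Let `A` be the arcs through the cutting point, and `B` the arcs through a point just
beyond all of `A`.  One interval graph serves the non-edges outside `A`, one those outside `B`; the
remaining non-edges join `A` to `B`, their chains under `Precedes` are cocktail parties, and each of
the at most `k` antichains is served by one interval graph. -/
theorem IsCutModel.hasBoxRep [Finite V] (h : IsCutModel G l r) (k : ℕ)
    (hk : ∀ L, IsCocktailParty G Set.univ L → L.length ≤ k) : HasBoxRep G (k + 2) := by
  classical
  have := Fintype.ofFinite V
  -- only the vertices in `N`, which are not adjacent to all others, have non-edges
  let N : Set V := {v | ∃ w, Gᶜ.Adj v w}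
  obtain ⟨M, hM0, hM1, hM⟩ : ∃ M : ℝ, 0 ≤ M ∧ M < 1 ∧
      ∀ a ∈ N, 1 ≤ r a → r a ≤ 1 + M ∧ M < l a := by
    by_cases hne : {a | a ∈ N ∧ 1 ≤ r a}.Nonempty
    · obtain ⟨a₀, ⟨⟨w, hw⟩, ha₀⟩, hmax⟩ := Set.exists_max_image _ r (Set.toFinite _) hne
      refine ⟨r a₀ - 1, by linarith, by linarith [h.lt_add a₀, h.lt_one a₀], fun a ha ha1 => ⟨?_, ?_⟩⟩
      · linarith [hmax a ⟨ha, ha1⟩]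
      · exact h.not_cover hw ha₀ ha1
    · exact ⟨0, le_rfl, one_pos, fun a ha ha1 => absurd ⟨a, ha, ha1⟩ hne⟩
  let A : Set V := {v | v ∈ N ∧ 1 ≤ r v}
  let B : Set V := {v | v ∈ N ∧ l v ≤ M ∧ M < r v}
  have hBr : ∀ b ∈ B, r b < 1 := by
    intro b hb
    by_contra! h1
    linarith [(hM b hb.1 h1).2, hb.2.1]
  have hAB : ∀ a ∈ A, a ∉ B := fun a ha hb => by linarith [hBr a hb, ha.2]
  have hadjAB : ∀ a ∈ A, ∀ b ∈ B, (Gᶜ.Adj a b ↔ r b < l a ∧ r a < l b + 1) := by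
    intro a ha b hb
    obtain ⟨h1, h2⟩ := hM a ha.1 ha.2
    have h3 := hBr b hb
    have h4 := h.nonneg a
    have h5 := hb.2.1
    have h6 := ha.2
    rw [SimpleGraph.compl_adj, h.adj]
    have hne : a ≠ b := by rintro rfl; exact hAB a ha hb
    constructor
    · rintro ⟨-, h7⟩
      by_contra hcon
      refine h7 ⟨hne, ?_⟩
      by_cases h8 : r b < l a
      · right; right; by_contra! h9; exact hcon ⟨h8, h9⟩
      · left; constructor <;> linarith
    · rintro ⟨h7, h8⟩
      refine ⟨hne, ?_⟩
      rintro ⟨-, h9 | h9 | h9⟩ <;> linarith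
  let E : Set (V × V) := {e | e.1 ∈ A ∧ e.2 ∈ B ∧ Gᶜ.Adj e.1 e.2}
  -- chains are cocktail parties
  have hcross : ∀ e ∈ E, ∀ e' ∈ E, Precedes l r e e' → CrossAdj G e e' := by
    rintro ⟨a, b⟩ ⟨ha, hb, hab⟩ ⟨a', b'⟩ ⟨ha', hb', hab'⟩ ⟨h1, h2⟩
    dsimp only at *
    have e1 := (hadjAB a ha b hb).1 hab
    have e2 := (hadjAB a' ha' b' hb').1 hab'
    have m := hM a ha.1 ha.2
    have m' := hM a' ha'.1 ha'.2
    have n := hb.2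
    have n' := hb'.2
    have p := ha.2
    have p' := ha'.2
    have q := h.lt_one a
    have q' := h.lt_one a'
    refine ⟨(h.adj _ _).2 ⟨?_, Or.inl ⟨?_, ?_⟩⟩, (h.adj _ _).2 ⟨?_, Or.inl ⟨?_, ?_⟩⟩,
      (h.adj _ _).2 ⟨?_, Or.inr (Or.inl h1)⟩, (h.adj _ _).2 ⟨?_, Or.inl ⟨?_, ?_⟩⟩⟩ <;>
      dsimp only
    any_goals linarith
    · rintro rfl; linarith
    · rintro rfl; exact hAB _ ha hb'
    · rintro rfl; exact hAB _ ha' hb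
    · rintro rfl; linarith
  have hord : ∀ e ∈ E, r e.2 < l e.1 ∧ r e.1 < l e.2 + 1 :=
    fun e he => (hadjAB e.1 he.1 e.2 he.2.1).1 he.2.2
  obtain ⟨c, hck, hc⟩ := exists_antichain_coloring E (Precedes l r)
    (fun a _ b hb c _ hab hbc =>
      ⟨by linarith [hab.1, hbc.1, (hord b hb).2], by linarith [hab.2, hbc.2, (hord b hb).1]⟩) k
    fun L hL hLE => hk L ⟨hL.imp_of_mem fun he he' => hcross _ (hLE _ he) _ (hLE _ he'),
      fun e he => ⟨(hLE e he).2.2, trivial, trivial⟩⟩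
  -- each antichain is served by thresholds
  let S : V → V → Prop := fun a b => a ∈ A ∧ b ∈ B ∧ ¬ Gᶜ.Adj a b
  let F : ℕ → Finset (V × V) := fun i => Finset.univ.filter fun e => e ∈ E ∧ c e = i
  have hF : ∀ {i e}, e ∈ F i ↔ e ∈ E ∧ c e = i := by simp [F]
  have hrank : ∀ i, ∃ ρ : V × V → ℕ, ∀ e ∈ F i, ∀ e' ∈ F i, S e'.1 e.2 → ρ e < ρ e' := by
    intro i
    refine exists_rank (fun e e' => S e'.1 e.2) (F i) fun F' hF' hne => ?_
    obtain ⟨e₁, he₁, hmin⟩ := Finset.exists_min_image F' (fun e => l e.2) hne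
    obtain ⟨e₂, he₂, hmax⟩ := Finset.exists_max_image F' (fun e => r e.2) hne
    have hE : ∀ e ∈ F', e ∈ E ∧ c e = i := fun e he => hF.1 (hF' he)
    -- if neither `e₁` nor `e₂` were minimal, then `e₁` would precede `e₂`
    by_contra! hcon
    have hpred : ∀ e ∈ F', ∃ e' ∈ F', l e.1 ≤ r e'.2 ∨ l e'.2 + 1 ≤ r e.1 := by
      intro e he
      obtain ⟨e', he', h1, h2, h3⟩ := hcon e he
      refine ⟨e', he', ?_⟩
      rw [hadjAB _ h1 _ h2] at h3
      by_contra! h4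
      exact h3 h4
    have o₁ := hord e₁ (hE e₁ he₁).1
    have o₂ := hord e₂ (hE e₂ he₂).1
    refine hc e₁ (hE e₁ he₁).1 e₂ (hE e₂ he₂).1 ⟨?_, ?_⟩
      ((hE e₁ he₁).2.trans (hE e₂ he₂).2.symm)
    · obtain ⟨e', he', h1 | h1⟩ := hpred e₂ he₂
      · linarith [hmax e' he']
      · linarith [hmin e' he']
    · obtain ⟨e', he', h1 | h1⟩ := hpred e₁ he₁
      · linarith [hmax e' he']
      · linarith [hmin e' he']
  choose ρ hρ using hrank
  choose f g K hgK hfg hgf using fun i => exists_thresholds (F i) S (ρ i) (hρ i)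
  have hcard : Fintype.card (Option (Option (Fin k))) = k + 2 := by simp
  rw [← hcard]
  have b0 := h.nonneg
  have b1 := h.lt_one
  have b2 := h.lt
  have b3 := h.lt_add
  -- intervals of vertices that are not involved reach from one end of the line to the other
  let lo : Option (Option (Fin k)) → V → ℝ
    | none, v => if v ∈ N ∧ v ∉ A then l v else -5
    | some none, v => if v ∈ N ∧ v ∉ B then (if r v ≤ M then l v + 1 else l v) else -5
    | some (some i), v => if v ∈ B then g i v else -1
  let hi : Option (Option (Fin k)) → V → ℝ
    | none, v => if v ∈ N ∧ v ∉ A then r v else 5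
    | some none, v => if v ∈ N ∧ v ∉ B then (if r v ≤ M then r v + 1 else r v) else 5
    | some (some i), v => if v ∈ A then f i v else K i + 1
  have hA : ∀ v, v ∈ N ∧ v ∉ A → r v < 1 := fun v hv => by
    by_contra! h1
    exact hv.2 ⟨hv.1, h1⟩
  have hB : ∀ v, v ∈ N ∧ v ∉ B → ¬ r v ≤ M → M < l v ∧ r v ≤ M + 1 := fun v hv h1 => by
    have h2 : M < l v := by
      by_contra! h2
      exact hv.2 ⟨hv.1, h2, not_le.1 h1⟩
    refine ⟨h2, ?_⟩
    rcases lt_or_ge (r v) 1 with h3 | h3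
    · linarith
    · linarith [(hM v hv.1 h3).1]
  refine hasBoxRep_of_endpoints lo hi ?_ fun u v huv => ⟨fun hadj => ?_, fun hall => ?_⟩
  · rintro (_ | _ | i) v
    · simp only [lo, hi]
      split_ifs <;> linarith [b2 v]
    · simp only [lo, hi]
      split_ifs <;> linarith [b2 v]
    · simp only [lo, hi]
      have h1 : (g i v : ℝ) ≤ K i := by exact_mod_cast hgK i v
      have h2 : (0 : ℝ) ≤ f i v := Nat.cast_nonneg _
      have h3 : (0 : ℝ) ≤ K i := Nat.cast_nonneg _
      split_ifs with h4 h5 h5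
      · exact absurd h4 (hAB v h5)
      all_goals linarith
  · have b0u := b0 u
    have b0v := b0 v
    have b1u := b1 u
    have b1v := b1 v
    have b2u := b2 u
    have b2v := b2 v
    have b3u := b3 u
    have b3v := b3 v
    have hmeet := ((h.adj u v).1 hadj).2
    rintro (_ | _ | i)
    · simp only [lo, hi]
      split_ifs with h1 h2 h2
      · have := hA u h1
        have := hA v h2
        rcases hmeet with h3 | h3 | h3
        · exact h3
        · linarith
        · linarith
      all_goals constructor <;> linarith
    · simp only [lo, hi]
      by_cases h1 : u ∈ N ∧ u ∉ B <;> by_cases h2 : v ∈ N ∧ v ∉ B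
      · rw [if_pos h1, if_pos h1, if_pos h2, if_pos h2]
        have hu := hB u h1
        have hv := hB v h2
        split_ifs with h3 h4 h4
        · rcases hmeet with h5 | h5 | h5
          · constructor <;> linarith
          · linarith
          · linarith
        · have := hv h4
          rcases hmeet with h5 | h5 | h5
          · linarith
          · constructor <;> linarith
          · linarith
        · have := hu h3
          rcases hmeet with h5 | h5 | h5
          · linarith
          · linarith
          · constructor <;> linarith
        · have := hu h3
          have := hv h4
          rcases hmeet with h5 | h5 | h5
          · exact h5
          · linarith
          · linarith
      · rw [if_pos h1, if_pos h1, if_neg h2, if_neg h2]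
        constructor <;> split_ifs <;> linarith
      · rw [if_neg h1, if_neg h1, if_pos h2, if_pos h2]
        constructor <;> split_ifs <;> linarith
      · rw [if_neg h1, if_neg h1, if_neg h2, if_neg h2]
        constructor <;> linarith
    · have hone : ∀ u v, G.Adj u v → lo (some (some i)) u ≤ hi (some (some i)) v := by
        intro u v huv
        simp only [lo, hi]
        have h1 : (g i u : ℝ) ≤ K i := by exact_mod_cast hgK i u
        have h2 : (0 : ℝ) ≤ f i v := Nat.cast_nonneg _
        have h3 : (0 : ℝ) ≤ K i := Nat.cast_nonneg _
        split_ifs with h4 h5 h5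
        · exact_mod_cast hgf i v u
            ⟨h5, h4, fun h6 => ((SimpleGraph.compl_adj ..).1 h6).2 huv.symm⟩
        all_goals linarith
      exact ⟨hone u v hadj, hone v u hadj.symm⟩
  · by_contra hadj
    have hc' : Gᶜ.Adj u v := (SimpleGraph.compl_adj ..).2 ⟨huv, hadj⟩
    have huN : u ∈ N := ⟨v, hc'⟩
    have hvN : v ∈ N := ⟨u, hc'.symm⟩
    have hsep : ∀ a ∈ A, ∀ b ∈ B, Gᶜ.Adj a b →
        ∃ i, ¬ lo (some (some i)) b ≤ hi (some (some i)) a := by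
      intro a ha b hb hab
      have hE : (a, b) ∈ E := ⟨ha, hb, hab⟩
      refine ⟨⟨c (a, b), hck _ hE⟩, ?_⟩
      simp only [lo, hi, if_pos ha, if_pos hb, not_le]
      exact_mod_cast hfg _ (a, b) (hF.2 ⟨hE, rfl⟩)
    by_cases hA' : u ∉ A ∧ v ∉ A
    · have h1 := hall none
      simp only [lo, hi, if_pos (And.intro huN hA'.1), if_pos (And.intro hvN hA'.2)] at h1
      exact hadj ((h.adj u v).2 ⟨huv, Or.inl h1⟩)
    · by_cases hB' : u ∉ B ∧ v ∉ B
      · have h1 := hall (some none)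
        simp only [lo, hi, if_pos (And.intro huN hB'.1), if_pos (And.intro hvN hB'.2)] at h1
        refine hadj ((h.adj u v).2 ⟨huv, ?_⟩)
        split_ifs at h1
        · exact Or.inl ⟨by linarith [h1.1], by linarith [h1.2]⟩
        · exact Or.inr (Or.inl h1.1)
        · exact Or.inr (Or.inr h1.2)
        · exact Or.inl h1
      · by_cases hu : u ∈ A
        · by_cases hv : v ∈ B
          · obtain ⟨i, hi⟩ := hsep u hu v hv hc'
            exact hi (hall (some (some i))).2
          · exact hB' ⟨hAB u hu, hv⟩
        · by_cases hv : v ∈ A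
          · by_cases hu' : u ∈ B
            · obtain ⟨i, hi⟩ := hsep v hv u hu' hc'.symm
              exact hi (hall (some (some i))).1
            · exact hB' ⟨hu', hAB v hv⟩
          · exact hA' ⟨hu, hv⟩

end

/-! ### Polynomial time programs -/

namespace RAM

/-- The state `σ` with the value `v` in register `x`. -/
def State.set (σ : State) (x v : ℕ) : State := { σ with reg := Function.update σ.reg x v }

@[simp] theorem State.set_reg (σ : State) (x v y : ℕ) :
    (σ.set x v).reg y = if y = x then v else σ.reg y := by
  simp [State.set, Function.update_apply]

theorem State.set_set (σ : State) (x v w : ℕ) : (σ.set x v).set x w = σ.set x w := by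
  simp [State.set]

theorem State.set_self (σ : State) (x : ℕ) : σ.set x (σ.reg x) = σ := by
  simp [State.set]

/-- The state `σ` with the value `v` in cell `i` of array `a`. -/
def State.put (σ : State) (a i v : ℕ) : State :=
  { σ with arr := Function.update σ.arr a (Function.update (σ.arr a) i v) }

theorem State.put_arr (σ : State) (a i v b j : ℕ) :
    (σ.put a i v).arr b j = if b = a ∧ j = i then v else σ.arr b j := by
  by_cases hb : b = a
  · subst hb
    by_cases hj : j = i <;> simp [State.put, hj]
  · simp [State.put, hb]

/-- Total correctness within polynomial time: from a state satisfying `P a`, the program halts in a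
state satisfying `Q a`, after a number of steps that is bounded by a polynomial in the content of
register `0`, which is left unchanged.  The parameter `a` ties `Q` to `P`; the polynomial does not
depend on it. -/
def PolyTime {α : Type} (p : Prog) (P Q : α → State → Prop) : Prop :=
  ∃ T : Polynomial ℕ, ∀ a σ, P a σ →
    ∃ k τ, Runs p σ k τ ∧ k ≤ T.eval (σ.reg 0) ∧ τ.reg 0 = σ.reg 0 ∧ Q a τ

section

variable {α β : Type}

theorem PolyTime.conseq {p : Prog} {P Q : α → State → Prop} {P' Q' : β → State → Prop}
    (h : PolyTime p P Q)
    (h' : ∀ b σ, P' b σ → ∃ a, P a σ ∧ ∀ τ, τ.reg 0 = σ.reg 0 → Q a τ → Q' b τ) :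
    PolyTime p P' Q' := by
  obtain ⟨T, hT⟩ := h
  refine ⟨T, fun b σ hσ => ?_⟩
  obtain ⟨a, ha, hQ⟩ := h' b σ hσ
  obtain ⟨k, τ, h1, h2, h3, h4⟩ := hT a σ ha
  exact ⟨k, τ, h1, h2, h3, hQ τ h3 h4⟩

theorem polyTime_skip {P Q : α → State → Prop} (h : ∀ a σ, P a σ → Q a σ) :
    PolyTime .skip P Q :=
  ⟨1, fun a σ hσ => ⟨1, σ, .skip σ, by simp, rfl, h a σ hσ⟩⟩

theorem polyTime_assign {x : ℕ} {e : Expr} {P Q : α → State → Prop} (hx : x ≠ 0)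
    (h : ∀ a σ, P a σ → Q a (σ.set x (e.eval σ))) : PolyTime (.assign x e) P Q :=
  ⟨Polynomial.C (e.cost + 1), fun a σ hσ =>
    ⟨_, _, .assign σ x e, by simp, by simp [hx.symm], h a σ hσ⟩⟩

theorem polyTime_store {a : ℕ} {i e : Expr} {P Q : α → State → Prop}
    (h : ∀ c σ, P c σ → Q c (σ.put a (i.eval σ) (e.eval σ))) : PolyTime (.store a i e) P Q :=
  ⟨Polynomial.C (i.cost + e.cost + 1), fun c σ hσ =>
    ⟨_, _, .store σ a i e, by simp, rfl, h c σ hσ⟩⟩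

theorem PolyTime.seq {p q : Prog} {P Q R : α → State → Prop} (hp : PolyTime p P Q)
    (hq : PolyTime q Q R) : PolyTime (.seq p q) P R := by
  obtain ⟨S, hS⟩ := hp
  obtain ⟨T, hT⟩ := hq
  refine ⟨S + T, fun a σ hσ => ?_⟩
  obtain ⟨j, τ, h1, h2, h3, h4⟩ := hS a σ hσ
  obtain ⟨k, υ, h5, h6, h7, h8⟩ := hT a τ h4
  refine ⟨j + k, υ, h1.seq h5, ?_, h7.trans h3, h8⟩
  rw [Polynomial.eval_add, ← h3]
  rw [← h3] at h2
  omega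

theorem PolyTime.branch {e : Expr} {p q : Prog} {P Q : α → State → Prop}
    (hp : PolyTime p (fun a σ => P a σ ∧ e.eval σ ≠ 0) Q)
    (hq : PolyTime q (fun a σ => P a σ ∧ e.eval σ = 0) Q) : PolyTime (.branch e p q) P Q := by
  obtain ⟨S, hS⟩ := hp
  obtain ⟨T, hT⟩ := hq
  refine ⟨Polynomial.C (e.cost + 1) + S + T, fun a σ hσ => ?_⟩
  simp only [Polynomial.eval_add, Polynomial.eval_C]
  by_cases he : e.eval σ = 0
  · obtain ⟨k, τ, h1, h2, h3⟩ := hT a σ ⟨hσ, he⟩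
    exact ⟨_, τ, .branch_false he h1, by omega, h3⟩
  · obtain ⟨k, τ, h1, h2, h3⟩ := hS a σ ⟨hσ, he⟩
    exact ⟨_, τ, .branch_true he h1, by omega, h3⟩

/-- The loop rule: the invariant `I` is maintained, and the variant `μ`, which is at most the
content of register `0`, decreases with every round. -/
theorem PolyTime.loop {e : Expr} {p : Prog} {I : α → State → Prop} (μ : α → State → ℕ)
    (hμ : ∀ a σ, I a σ → μ a σ ≤ σ.reg 0)
    (hp : PolyTime (α := α × ℕ) p (fun a σ => I a.1 σ ∧ e.eval σ ≠ 0 ∧ μ a.1 σ = a.2)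
      (fun a τ => I a.1 τ ∧ μ a.1 τ < a.2)) :
    PolyTime (.loop e p) I (fun a τ => I a τ ∧ e.eval τ = 0) := by
  obtain ⟨T, hT⟩ := hp
  refine ⟨.X * (Polynomial.C (e.cost + 1) + T) + Polynomial.C (e.cost + 1), fun a σ hσ => ?_⟩
  simp only [Polynomial.eval_add, Polynomial.eval_mul, Polynomial.eval_X, Polynomial.eval_C]
  have key : ∀ m σ, I a σ → μ a σ ≤ m → ∃ k τ, Runs (.loop e p) σ k τ ∧
      k ≤ m * (e.cost + 1 + T.eval (σ.reg 0)) + (e.cost + 1) ∧ τ.reg 0 = σ.reg 0 ∧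
      I a τ ∧ e.eval τ = 0 := by
    intro m
    induction m with
    | zero =>
      intro σ hσ hm
      by_cases he : e.eval σ = 0
      · exact ⟨_, σ, .loop_done he, by simp, rfl, hσ, he⟩
      · obtain ⟨k, τ, -, -, -, -, h5⟩ := hT (a, μ a σ) σ ⟨hσ, he, rfl⟩
        dsimp only at h5
        omega
    | succ m ih =>
      intro σ hσ hm
      by_cases he : e.eval σ = 0
      · exact ⟨_, σ, .loop_done he, by simp, rfl, hσ, he⟩
      · obtain ⟨j, τ, h1, h2, h3, h4, h5⟩ := hT (a, μ a σ) σ ⟨hσ, he, rfl⟩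
        dsimp only at h5
        obtain ⟨k, υ, h6, h7, h8, h9⟩ := ih τ h4 (by omega)
        refine ⟨_, υ, .loop_step he h1 h6, ?_, h8.trans h3, h9⟩
        rw [h3] at h7
        rw [Nat.succ_mul]
        omega
  exact key _ σ hσ (hμ a σ hσ)

/-- `for x < n do p`, where register `0` holds `n`. -/
def forProg (x : ℕ) (p : Prog) : Prog :=
  .seq (.assign x (.num 0)) (.loop (.sub (.var 0) (.var x))
    (.seq p (.assign x (.add (.var x) (.num 1)))))

theorem PolyTime.forProg {x : ℕ} {p : Prog} (hx : x ≠ 0) (I : α → ℕ → State → Prop)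
    (hI : ∀ a i σ v, I a i σ → I a i (σ.set x v))
    (hp : PolyTime (α := α × ℕ) p (fun a σ => I a.1 a.2 σ ∧ σ.reg x = a.2 ∧ a.2 < σ.reg 0)
      (fun a τ => I a.1 (a.2 + 1) τ ∧ τ.reg x = a.2)) :
    PolyTime (RAM.forProg x p) (fun a σ => I a 0 σ) (fun a σ => I a (σ.reg 0) σ) := by
  let J : α → State → Prop := fun a σ => I a (σ.reg x) σ ∧ σ.reg x ≤ σ.reg 0
  have hloop : PolyTime (.loop (.sub (.var 0) (.var x))
      (.seq p (.assign x (.add (.var x) (.num 1))))) J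
      (fun a σ => J a σ ∧ (Expr.sub (.var 0) (.var x)).eval σ = 0) := by
    refine PolyTime.loop (fun _ σ => σ.reg 0 - σ.reg x) (fun _ _ _ => Nat.sub_le _ _) ?_
    obtain ⟨T, hT⟩ := hp
    refine PolyTime.seq (Q := fun a τ => I a.1 (τ.reg x + 1) τ ∧ τ.reg x < τ.reg 0 ∧
      τ.reg 0 - τ.reg x = a.2) ⟨T, ?_⟩ (polyTime_assign hx ?_)
    · rintro ⟨a, m⟩ σ ⟨⟨h1, h2⟩, h3, h4⟩
      simp only [Expr.eval] at h3 h4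
      obtain ⟨k, τ, h5, h6, h7, h8, h9⟩ := hT (a, σ.reg x) σ ⟨h1, rfl, by dsimp only; omega⟩
      dsimp only at h8 h9
      refine ⟨k, τ, h5, h6, h7, by rwa [h9], ?_, ?_⟩ <;> (try dsimp only) <;> omega
    · rintro ⟨a, m⟩ σ ⟨h1, h2, h3⟩
      simp only [Expr.eval, J] at h3 ⊢
      refine ⟨⟨?_, ?_⟩, ?_⟩
      · simpa using hI _ _ _ _ h1
      · simpa [hx.symm] using h2
      · simp only [State.set_reg, hx.symm, if_true, if_false]
        omega
  refine (PolyTime.seq (polyTime_assign (P := fun a σ => I a 0 σ) (Q := J) hx ?_) hloop).conseq ?_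
  · intro a σ h
    exact ⟨by simpa [Expr.eval] using hI _ _ _ _ h, by simp [Expr.eval]⟩
  · rintro a σ h
    refine ⟨a, h, fun τ _ h' => ?_⟩
    obtain ⟨⟨h1, h2⟩, h3⟩ := h'
    simp only [Expr.eval] at h3
    rwa [show τ.reg 0 = τ.reg x by omega]

/-! ### Searching for witnesses -/

/-- Logical negation of an expression; nonzero values stand for truth. -/
def Expr.not (e : Expr) : Expr := .sub (.num 1) e

/-- Logical conjunction of two expressions. -/
def Expr.and (e₁ e₂ : Expr) : Expr := Expr.not (.add e₁.not e₂.not)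

theorem Expr.eval_not_ne_zero {e : Expr} {σ : State} : e.not.eval σ ≠ 0 ↔ e.eval σ = 0 := by
  simp only [Expr.not, Expr.eval]
  omega

theorem Expr.eval_and_ne_zero {e₁ e₂ : Expr} {σ : State} :
    (e₁.and e₂).eval σ ≠ 0 ↔ e₁.eval σ ≠ 0 ∧ e₂.eval σ ≠ 0 := by
  simp only [Expr.and, Expr.not, Expr.eval]
  omega

/-- Two states agree on all arrays and on the registers below `m`, except the flag register `1`. -/
def Agree (m : ℕ) (σ τ : State) : Prop :=
  τ.arr = σ.arr ∧ ∀ r < m, r ≠ 1 → τ.reg r = σ.reg r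

theorem Agree.reg {m : ℕ} {σ τ : State} (h : Agree m σ τ) (r : ℕ) (hr : r < m) (h1 : r ≠ 1) :
    τ.reg r = σ.reg r :=
  h.2 r hr h1

/-- The program tests the condition `φ` on the initial state, with the answer in the flag register
`1`.  If it is positive, the final state has the property `W`, so that it provides a witness. -/
def Finds (p : Prog) (m : ℕ) (φ W : State → Prop) : Prop :=
  PolyTime p (fun σ₀ σ => σ = σ₀)
    (fun σ₀ τ => Agree m σ₀ τ ∧ (τ.reg 1 = 0 → ¬ φ σ₀) ∧ (τ.reg 1 ≠ 0 → W τ))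

/-- Search for the first `i < n` for which `p` raises the flag; then `i + 1` is left in
register `m`. -/
def searchProg (m : ℕ) (p : Prog) : Prog :=
  .seq (.assign 1 (.num 0)) (.seq (.assign m (.num 0))
    (.loop ((Expr.sub (.var 0) (.var m)).and (Expr.var 1).not)
      (.seq p (.assign m (.add (.var m) (.num 1))))))

theorem Finds.search {p : Prog} {m : ℕ} {φ W : State → Prop} (hm : 2 ≤ m)
    (hφ : ∀ σ τ, Agree (m + 1) σ τ → φ σ → φ τ) (hp : Finds p (m + 1) φ W) :
    Finds (searchProg m p) m (fun σ => ∃ i < σ.reg 0, φ (σ.set m i))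
      (fun τ => 0 < τ.reg m ∧ τ.reg m ≤ τ.reg 0 ∧ W (τ.set m (τ.reg m - 1))) := by
  let I : State → State → Prop := fun σ₀ σ => Agree m σ₀ σ ∧ σ.reg m ≤ σ.reg 0 ∧
    (σ.reg 1 = 0 → ∀ i < σ.reg m, ¬ φ (σ₀.set m i)) ∧
    (σ.reg 1 ≠ 0 → 0 < σ.reg m ∧ W (σ.set m (σ.reg m - 1)))
  have hm0 : (0 : ℕ) ≠ m := by omega
  have hm1 : (1 : ℕ) ≠ m := by omega
  refine PolyTime.seq (polyTime_assign (Q := fun σ₀ σ => Agree m σ₀ σ ∧ σ.reg 1 = 0) one_ne_zero ?_)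
    (PolyTime.seq (polyTime_assign (Q := I) hm0.symm ?_)
    ((PolyTime.loop (I := I) (fun _ σ => σ.reg 0 - σ.reg m) (fun _ _ _ => Nat.sub_le _ _)
      (PolyTime.seq (Q := fun a τ => I a.1 (τ.set m (τ.reg m + 1)) ∧ τ.reg m < τ.reg 0 ∧
        τ.reg 0 - τ.reg m = a.2)
        (hp.conseq ?_) (polyTime_assign hm0.symm ?_))).conseq ?_))
  · rintro σ₀ σ rfl
    refine ⟨⟨rfl, fun r _ h1 => ?_⟩, ?_⟩ <;> simp [Expr.eval, *]
  · rintro σ₀ σ ⟨⟨h1, h2⟩, h3⟩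
    refine ⟨⟨h1, fun r hr hr1 => ?_⟩, ?_, ?_, ?_⟩
    · simp [hr.ne, h2 r hr hr1]
    · simp [Expr.eval]
    · simp [Expr.eval]
    · simp [hm1, h3]
  · rintro ⟨σ₀, k⟩ σ ⟨⟨h1, h2, h3, -⟩, h5, h6⟩
    rw [Expr.eval_and_ne_zero, Expr.eval_not_ne_zero] at h5
    simp only [Expr.eval] at h5 h6
    refine ⟨σ, rfl, ?_⟩
    rintro τ h0 ⟨ha, hn, hW⟩
    have hreg : τ.reg m = σ.reg m := ha.2 m (by omega) (by omega)
    refine ⟨⟨⟨ha.1.trans h1.1, fun r hr hr1 => ?_⟩, ?_, ?_, ?_⟩, ?_, ?_⟩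
    · simp only [State.set_reg, hr.ne, if_false]
      exact (ha.2 r (by omega) hr1).trans (h1.2 r hr hr1)
    · simp only [State.set_reg, hm0, if_true, if_false]
      omega
    · simp only [State.set_reg, hm1, if_true, if_false]
      intro hf i hi hi'
      rcases Nat.lt_succ_iff_lt_or_eq.1 hi with hi | rfl
      · exact h3 h5.2 i (by omega) hi'
      · refine hn hf (hφ (σ₀.set _ _) _ ⟨h1.1, fun r hr hr1 => ?_⟩ hi')
        rcases Nat.lt_succ_iff_lt_or_eq.1 hr with hr | rfl
        · simp only [State.set_reg, hr.ne, if_false]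
          exact h1.2 r hr hr1
        · simp [hreg]
    · simp only [State.set_reg, hm1, if_true, if_false]
      intro hf
      refine ⟨by omega, ?_⟩
      rw [State.set_set, Nat.add_sub_cancel, State.set_self]
      exact hW hf
    · omega
    · simp only; omega
  · rintro ⟨σ₀, k⟩ σ ⟨h1, h2, h3⟩
    refine ⟨h1, ?_⟩
    simp only [Expr.eval, State.set_reg, hm0, if_true, if_false] at h3 ⊢
    omega
  · rintro σ₀ σ hI
    refine ⟨σ₀, hI, ?_⟩
    rintro τ h0 ⟨⟨h1, h2, h3, h4⟩, h5⟩
    refine ⟨h1, fun hf => ?_, fun hf => ⟨(h4 hf).1, h2, (h4 hf).2⟩⟩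
    have h6 : ¬ (Expr.sub (.var 0) (.var m)).eval τ ≠ 0 := by
      intro h6
      exact Expr.eval_and_ne_zero.2 ⟨h6, Expr.eval_not_ne_zero.2 (by exact hf)⟩ h5
    simp only [Expr.eval] at h6
    rintro ⟨i, hi, hi'⟩
    have := h1.2 0 (by omega) (by omega)
    exact h3 hf i (by omega) hi'

theorem Agree.exists_lt {m : ℕ} {φ : State → Prop} (hm : 2 ≤ m)
    (hφ : ∀ σ τ, Agree (m + 1) σ τ → φ σ → φ τ) (σ τ : State) (h : Agree m σ τ)
    (hσ : ∃ i < σ.reg 0, φ (σ.set m i)) : ∃ i < τ.reg 0, φ (τ.set m i) := by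
  obtain ⟨i, hi, hi'⟩ := hσ
  refine ⟨i, by rwa [h.2 0 (by omega) (by omega)], hφ (σ.set m i) _ ⟨h.1, fun r hr hr1 => ?_⟩ hi'⟩
  rcases Nat.lt_succ_iff_lt_or_eq.1 hr with hr | rfl
  · simp [hr.ne, h.2 r hr hr1]
  · simp

theorem finds_assign (e : Expr) (m : ℕ) (he : ∀ σ v, e.eval (σ.set 1 v) = e.eval σ) :
    Finds (.assign 1 e) m (fun σ => e.eval σ ≠ 0) (fun τ => e.eval τ ≠ 0) := by
  refine polyTime_assign one_ne_zero ?_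
  rintro σ₀ σ rfl
  refine ⟨⟨rfl, fun r _ h1 => by simp [h1]⟩, ?_, ?_⟩ <;> simp [he]

end

end RAM

/-! ### The algorithm -/

namespace RAM

/-- Adjacency of the vertices in registers `a` and `b`.  Array `1` holds the row offsets `i * n`,
so that no multiplication is needed. -/
def adjExpr (a b : ℕ) : Expr := .get 0 (.add (.get 1 (.var a)) (.var b))

/-- The vertices in registers `a` and `b` form a non-edge. -/
def nonAdjExpr (a b : ℕ) : Expr :=
  (Expr.add (.sub (.var a) (.var b)) (.sub (.var b) (.var a))).and (adjExpr a b).not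

/-- The vertices in registers `a` and `b` form a non-edge in the set held by array `2`. -/
def nonEdgeExpr (a b : ℕ) : Expr :=
  (Expr.get 2 (.var a)).and ((Expr.get 2 (.var b)).and (nonAdjExpr a b))

/-- The pairs in registers `a`, `b` and `c`, `d` are joined by all four edges. -/
def crossExpr (a b c d : ℕ) : Expr :=
  (adjExpr a c).and ((adjExpr a d).and ((adjExpr b c).and (adjExpr b d)))

/-- Registers `9` to `12` hold two non-edges which refute that the non-edge in registers `7`, `8`
is simplicial. -/
def obstructionExpr : Expr :=
  (nonEdgeExpr 9 10).and ((nonEdgeExpr 11 12).and ((crossExpr 7 8 9 10).not.and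
    ((crossExpr 7 8 11 12).not.and (crossExpr 9 10 11 12))))

/-- Test whether registers `7`, `8` hold a simplicial non-edge of the set held by array `2`. -/
def simplicialProg : Prog :=
  .seq (searchProg 9 (searchProg 10 (searchProg 11 (searchProg 12 (.assign 1 obstructionExpr)))))
    (.assign 1 ((nonEdgeExpr 7 8).and (Expr.var 1).not))

/-- Search for a simplicial non-edge `(u, v)`, leaving `u + 1` and `v + 1` in registers `7`, `8`. -/
def findProg : Prog := searchProg 7 (searchProg 8 simplicialProg)

/-- Let array `2` hold the set of those vertices for which `e` is nonzero. -/
def fillProg (e : Expr) : Prog := forProg 6 (.store 2 (.var 6) e)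

/-- Put the simplicial non-edge found into the cocktail party counted by register `3`, and keep
the common neighbours of its ends. -/
def greedyStepProg : Prog :=
  .seq (.assign 3 (.add (.var 3) (.num 1))) (.seq (.assign 7 (.sub (.var 7) (.num 1)))
    (.seq (.assign 8 (.sub (.var 8) (.num 1)))
      (.seq (fillProg ((Expr.get 2 (.var 6)).and ((adjExpr 7 6).and (adjExpr 8 6)))) findProg)))

/-- The largest cocktail party through the non-edge in registers `4`, `5`, computed greedily; the
result is compared with the best one so far, in register `2`. -/
def greedyProg : Prog :=
  .seq (fillProg ((adjExpr 4 6).and (adjExpr 5 6))) (.seq (.assign 3 (.num 1)) (.seq findProg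
    (.seq (.loop (.var 1) greedyStepProg)
      (.branch (.sub (.var 3) (.var 2)) (.assign 2 (.var 3)) .skip))))

/-- Compute the row offsets `i * n`. -/
def offsetProg : Prog :=
  forProg 6 (.store 1 (.add (.var 6) (.num 1)) (.add (.get 1 (.var 6)) (.var 0)))

/-- The size of a largest cocktail party, in register `2`. -/
def partyProg : Prog :=
  .seq offsetProg (forProg 4 (forProg 5 (.branch (nonAdjExpr 4 5) greedyProg .skip)))

/-- The memory represents the graph `G`: array `0` holds its adjacency matrix, with the row offsets
in array `1`. -/
def Encodes {n : ℕ} (G : SimpleGraph (Fin n)) (σ : State) : Prop :=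
  σ.reg 0 = n ∧ ∀ i j : Fin n, σ.arr 0 (σ.arr 1 i + j) ≠ 0 ↔ G.Adj i j

/-- The set of vertices held by array `2`. -/
def alive (n : ℕ) (σ : State) : Set (Fin n) := {i | σ.arr 2 i ≠ 0}

section

variable {n : ℕ} {G : SimpleGraph (Fin n)} {σ : State}

theorem mem_alive {i : Fin n} : i ∈ alive n σ ↔ σ.arr 2 i ≠ 0 := Iff.rfl

theorem Encodes.adj_iff (h : Encodes G σ) {a b : ℕ} (u v : Fin n) (hu : σ.reg a = u)
    (hv : σ.reg b = v) : (adjExpr a b).eval σ ≠ 0 ↔ G.Adj u v := by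
  simp only [adjExpr, Expr.eval, hu, hv]
  exact h.2 u v

theorem Encodes.nonAdj_iff (h : Encodes G σ) {a b : ℕ} (u v : Fin n) (hu : σ.reg a = u)
    (hv : σ.reg b = v) : (nonAdjExpr a b).eval σ ≠ 0 ↔ Gᶜ.Adj u v := by
  rw [nonAdjExpr, Expr.eval_and_ne_zero, Expr.eval_not_ne_zero, SimpleGraph.compl_adj,
    ← h.adj_iff u v hu hv, not_not, ← Fin.val_ne_iff]
  simp only [Expr.eval, hu, hv]
  refine and_congr_left fun _ => ?_
  omega

theorem Encodes.nonEdge_iff (h : Encodes G σ) {a b : ℕ} (u v : Fin n) (hu : σ.reg a = u)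
    (hv : σ.reg b = v) :
    (nonEdgeExpr a b).eval σ ≠ 0 ↔ u ∈ alive n σ ∧ v ∈ alive n σ ∧ Gᶜ.Adj u v := by
  rw [nonEdgeExpr, Expr.eval_and_ne_zero, Expr.eval_and_ne_zero, h.nonAdj_iff u v hu hv]
  simp only [Expr.eval, hu, hv, mem_alive]

theorem Encodes.cross_iff (h : Encodes G σ) {a b c d : ℕ} (u v w x : Fin n) (hu : σ.reg a = u)
    (hv : σ.reg b = v) (hw : σ.reg c = w) (hx : σ.reg d = x) :
    (crossExpr a b c d).eval σ ≠ 0 ↔ CrossAdj G (u, v) (w, x) := by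
  simp only [crossExpr, Expr.eval_and_ne_zero, h.adj_iff u w hu hw, h.adj_iff u x hu hx,
    h.adj_iff v w hv hw, h.adj_iff v x hv hx, CrossAdj]

theorem Encodes.obstruction_iff (h : Encodes G σ) (u v w x y z : Fin n) (hu : σ.reg 7 = u)
    (hv : σ.reg 8 = v) (hw : σ.reg 9 = w) (hx : σ.reg 10 = x) (hy : σ.reg 11 = y)
    (hz : σ.reg 12 = z) : obstructionExpr.eval σ ≠ 0 ↔
      (w ∈ alive n σ ∧ x ∈ alive n σ ∧ Gᶜ.Adj w x) ∧ (y ∈ alive n σ ∧ z ∈ alive n σ ∧ Gᶜ.Adj y z) ∧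
      ¬ CrossAdj G (u, v) (w, x) ∧ ¬ CrossAdj G (u, v) (y, z) ∧ CrossAdj G (w, x) (y, z) := by
  simp only [obstructionExpr, Expr.eval_and_ne_zero, Expr.eval_not_ne_zero,
    h.nonEdge_iff w x hw hx, h.nonEdge_iff y z hy hz, h.cross_iff w x y z hw hx hy hz,
    ← h.cross_iff u v w x hu hv hw hx, ← h.cross_iff u v y z hu hv hy hz, not_not]

theorem obstructionExpr_congr (σ τ : State) (h : Agree 13 σ τ) (hσ : obstructionExpr.eval σ ≠ 0) :
    obstructionExpr.eval τ ≠ 0 := by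
  have h7 := h.reg 7 (by norm_num) (by norm_num)
  have h8 := h.reg 8 (by norm_num) (by norm_num)
  have h9 := h.reg 9 (by norm_num) (by norm_num)
  have h10 := h.reg 10 (by norm_num) (by norm_num)
  have h11 := h.reg 11 (by norm_num) (by norm_num)
  have h12 := h.reg 12 (by norm_num) (by norm_num)
  convert hσ using 1
  simp only [obstructionExpr, nonEdgeExpr, nonAdjExpr, crossExpr, adjExpr,
    Expr.and, Expr.not, Expr.eval, h.1, h7, h8, h9, h10, h11, h12]

/-- Some values of registers `9` to `12` give an obstruction: the non-edge in registers `7`, `8` is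
not simplicial. -/
def Obstructed (σ : State) : Prop :=
  ∃ a < σ.reg 0, ∃ b < (σ.set 9 a).reg 0, ∃ c < ((σ.set 9 a).set 10 b).reg 0,
    ∃ d < (((σ.set 9 a).set 10 b).set 11 c).reg 0,
      obstructionExpr.eval ((((σ.set 9 a).set 10 b).set 11 c).set 12 d) ≠ 0

theorem Encodes.congr {τ : State} (h : Encodes G σ) (h0 : τ.reg 0 = σ.reg 0)
    (h1 : τ.arr 0 = σ.arr 0) (h2 : τ.arr 1 = σ.arr 1) : Encodes G τ :=
  ⟨h0.trans h.1, by rw [h1, h2]; exact h.2⟩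

theorem Encodes.obstructed (h : Encodes G σ) (u v : Fin n) (hu : σ.reg 7 = u)
    (hv : σ.reg 8 = v) : Obstructed σ ↔ ¬ IsSimplicial G (alive n σ) (u, v) := by
  have key : ∀ a b c d : Fin n,
      obstructionExpr.eval ((((σ.set 9 a).set 10 b).set 11 c).set 12 d) ≠ 0 ↔
      (a ∈ alive n σ ∧ b ∈ alive n σ ∧ Gᶜ.Adj a b) ∧ (c ∈ alive n σ ∧ d ∈ alive n σ ∧ Gᶜ.Adj c d) ∧
      ¬ CrossAdj G (u, v) (a, b) ∧ ¬ CrossAdj G (u, v) (c, d) ∧ CrossAdj G (a, b) (c, d) := by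
    intro a b c d
    exact Encodes.obstruction_iff (σ := (((σ.set 9 a).set 10 b).set 11 c).set 12 d)
      (h.congr (by simp) rfl rfl) u v a b c d (by simp [hu]) (by simp [hv]) (by simp) (by simp)
      (by simp) (by simp)
  constructor
  · rintro ⟨a, ha, b, hb, c, hc, d, hd, hbad⟩ hs
    simp only [State.set_reg, h.1] at ha hb hc hd
    obtain ⟨⟨a1, a2, a3⟩, ⟨b1, b2, b3⟩, c1, c2, c3⟩ :=
      (key ⟨a, ha⟩ ⟨b, hb⟩ ⟨c, hc⟩ ⟨d, hd⟩).1 hbad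
    exact hs _ _ a1 a2 a3 b1 b2 b3 c1 c2 c3
  · intro hs
    unfold IsSimplicial at hs
    push Not at hs
    obtain ⟨⟨a, b⟩, ⟨c, d⟩, a1, a2, a3, b1, b2, b3, c1, c2, c3⟩ := hs
    have h0 := h.1
    exact ⟨a, by simp [h0], b, by simp [h0], c, by simp [h0], d, by simp [h0],
      (key a b c d).2 ⟨⟨a1, a2, a3⟩, ⟨b1, b2, b3⟩, c1, c2, c3⟩⟩

/-- Registers `7`, `8` hold a simplicial non-edge of the set held by array `2`. -/
def Simplicial (σ : State) : Prop := (nonEdgeExpr 7 8).eval σ ≠ 0 ∧ ¬ Obstructed σ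

theorem Encodes.simplicial (h : Encodes G σ) (u v : Fin n) (hu : σ.reg 7 = u)
    (hv : σ.reg 8 = v) : Simplicial σ ↔ u ∈ alive n σ ∧ v ∈ alive n σ ∧ Gᶜ.Adj u v ∧
      IsSimplicial G (alive n σ) (u, v) := by
  rw [Simplicial, h.obstructed u v hu hv, h.nonEdge_iff u v hu hv, not_not, and_assoc, and_assoc]

theorem obstructed_congr (σ τ : State) (h : Agree 9 σ τ) (hσ : Obstructed σ) : Obstructed τ :=
  Agree.exists_lt (m := 9) (by norm_num) (Agree.exists_lt (m := 10) (by norm_num)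
    (Agree.exists_lt (m := 11) (by norm_num) (Agree.exists_lt (m := 12) (by norm_num)
      obstructionExpr_congr))) σ τ h hσ

theorem simplicial_congr (σ τ : State) (h : Agree 9 σ τ) (hσ : Simplicial σ) : Simplicial τ := by
  have h7 := h.reg 7 (by norm_num) (by norm_num)
  have h8 := h.reg 8 (by norm_num) (by norm_num)
  refine ⟨?_, fun h' => hσ.2 (obstructed_congr τ σ ⟨h.1.symm, fun r hr h1 => (h.2 r hr h1).symm⟩ h')⟩
  convert hσ.1 using 1
  simp only [nonEdgeExpr, nonAdjExpr, adjExpr, Expr.and, Expr.not, Expr.eval, h.1, h7,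
    h8]

theorem finds_simplicialProg : Finds simplicialProg 9 Simplicial Simplicial := by
  have h12 := (finds_assign obstructionExpr 13 (fun _ _ => rfl)).search (m := 12) (by norm_num)
    obstructionExpr_congr
  have h11 := h12.search (m := 11) (by norm_num) (Agree.exists_lt (by norm_num)
    obstructionExpr_congr)
  have h10 := h11.search (m := 10) (by norm_num) (Agree.exists_lt (by norm_num)
    (Agree.exists_lt (by norm_num) obstructionExpr_congr))
  have h9 := h10.search (m := 9) (by norm_num) (Agree.exists_lt (by norm_num)
    (Agree.exists_lt (by norm_num) (Agree.exists_lt (by norm_num) obstructionExpr_congr)))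
  refine PolyTime.seq (h9.conseq (Q' := fun σ₀ τ => Agree 9 σ₀ τ ∧
    (τ.reg 1 = 0 ↔ ¬ Obstructed σ₀)) ?_) (polyTime_assign one_ne_zero ?_)
  · rintro σ₀ σ rfl
    refine ⟨σ, rfl, ?_⟩
    rintro τ h0 ⟨ha, hn, hW⟩
    refine ⟨ha, hn, fun hob => ?_⟩
    by_contra hf
    -- the final state contains the witnesses in registers `9` to `12`
    obtain ⟨p9, q9, p10, q10, p11, q11, p12, q12, hW⟩ := hW hf
    refine hob (obstructed_congr τ σ ⟨ha.1.symm, fun r hr h1 => (ha.2 r hr h1).symm⟩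
      ⟨τ.reg 9 - 1, by omega, τ.reg 10 - 1, ?_, τ.reg 11 - 1, ?_, τ.reg 12 - 1, ?_, ?_⟩)
    · simp at p10 q10 ⊢; omega
    · simp at p11 q11 ⊢; omega
    · simp at p12 q12 ⊢; omega
    · simpa using hW
  · rintro σ₀ σ ⟨ha, hf⟩
    have hS : Simplicial σ ↔ Simplicial σ₀ := ⟨simplicial_congr σ σ₀
      ⟨ha.1.symm, fun r hr h1 => (ha.2 r hr h1).symm⟩, simplicial_congr σ₀ σ ha⟩
    have hO : Obstructed σ ↔ Obstructed σ₀ := ⟨obstructed_congr σ σ₀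
      ⟨ha.1.symm, fun r hr h1 => (ha.2 r hr h1).symm⟩, obstructed_congr σ₀ σ ha⟩
    have key : ((nonEdgeExpr 7 8).and (Expr.var 1).not).eval σ ≠ 0 ↔ Simplicial σ₀ := by
      rw [Expr.eval_and_ne_zero, Expr.eval_not_ne_zero, ← hS, Simplicial, hO, ← hf]
      rfl
    have hag : ∀ v, Agree 9 σ₀ (σ.set 1 v) := fun v =>
      ⟨ha.1, fun r hr h1 => by simpa [h1] using ha.2 r hr h1⟩
    refine ⟨hag _, ?_, ?_⟩
    · rw [State.set_reg, if_pos rfl, ← key, not_not]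
      exact id
    · rw [State.set_reg, if_pos rfl, key]
      exact simplicial_congr _ _ (hag _)

/-- `findProg` finds a simplicial non-edge of the set held by array `2` if there is one. -/
theorem polyTime_findProg : PolyTime findProg
    (fun (a : (Σ n, SimpleGraph (Fin n)) × State) σ => σ = a.2 ∧ Encodes a.1.2 σ)
    (fun a τ => Agree 7 a.2 τ ∧
      (τ.reg 1 ≠ 0 → ∃ u v : Fin a.1.1, τ.reg 7 = u + 1 ∧ τ.reg 8 = v + 1 ∧ u ∈ alive _ τ ∧
        v ∈ alive _ τ ∧ a.1.2ᶜ.Adj u v ∧ IsSimplicial a.1.2 (alive _ τ) (u, v)) ∧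
      (τ.reg 1 = 0 → ∀ u ∈ alive _ τ, ∀ v ∈ alive _ τ, a.1.2ᶜ.Adj u v →
        ¬ IsSimplicial a.1.2 (alive _ τ) (u, v))) := by
  have h8 := finds_simplicialProg.search (m := 8) (by norm_num) simplicial_congr
  have h7 := h8.search (m := 7) (by norm_num) (Agree.exists_lt (by norm_num) simplicial_congr)
  refine h7.conseq ?_
  rintro ⟨⟨n, G⟩, σ₀⟩ σ ⟨rfl, hE⟩
  dsimp only at hE
  refine ⟨σ, rfl, ?_⟩
  rintro τ h0 ⟨ha, hn, hW⟩
  have hE' : Encodes G τ := hE.congr h0 (by rw [ha.1]) (by rw [ha.1])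
  have halive : alive n τ = alive n σ := by rw [alive, ha.1]; rfl
  refine ⟨ha, fun hf => ?_, fun hf u hu v hv huv hs => hn hf ?_⟩
  · obtain ⟨p7, q7, p8, q8, hs⟩ := hW hf
    simp at p8 q8 hs
    rw [hE'.1] at q7 q8
    have hu : τ.reg 7 - 1 < n := by omega
    have hv : τ.reg 8 - 1 < n := by omega
    refine ⟨⟨_, hu⟩, ⟨_, hv⟩, by simp only; omega, by simp only; omega, ?_⟩
    exact (Encodes.simplicial (σ := (τ.set 7 (τ.reg 7 - 1)).set 8 (τ.reg 8 - 1))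
      (hE'.congr (by simp) rfl rfl) ⟨_, hu⟩ ⟨_, hv⟩ (by simp) (by simp)).1 hs
  · refine ⟨u, by rw [hE.1]; exact u.2, v, by simp [hE.1], ?_⟩
    rw [halive] at hu hv hs
    exact (Encodes.simplicial (σ := (σ.set 7 u).set 8 v)
      (hE.congr (by simp) rfl rfl) u v (by simp) (by simp)).2 ⟨hu, hv, huv, hs⟩

theorem polyTime_fillProg {α : Type} {e : Expr} {ψ : State → ℕ → Prop} {P : α → State → Prop}
    (h : ∀ σ₀ σ : State, σ.arr 0 = σ₀.arr 0 → σ.arr 1 = σ₀.arr 1 → (∀ r ≠ 6, σ.reg r = σ₀.reg r) →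
      σ.arr 2 (σ.reg 6) = σ₀.arr 2 (σ.reg 6) → (e.eval σ ≠ 0 ↔ ψ σ₀ (σ.reg 6))) :
    PolyTime (fillProg e) P (fun a τ => ∃ σ, P a σ ∧ τ.arr 0 = σ.arr 0 ∧ τ.arr 1 = σ.arr 1 ∧
      (∀ r ≠ 6, τ.reg r = σ.reg r) ∧ ∀ i < σ.reg 0, τ.arr 2 i ≠ 0 ↔ ψ σ i) := by
  have key := PolyTime.forProg (α := State) (x := 6) (p := .store 2 (.var 6) e) (by norm_num)
    (fun σ₀ k σ => σ.arr 0 = σ₀.arr 0 ∧ σ.arr 1 = σ₀.arr 1 ∧ (∀ r ≠ 6, σ.reg r = σ₀.reg r) ∧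
      ∀ i, if i < k then (σ.arr 2 i ≠ 0 ↔ ψ σ₀ i) else σ.arr 2 i = σ₀.arr 2 i) ?_ ?_
  · refine key.conseq fun a σ hσ => ⟨σ, by simp, ?_⟩
    rintro τ h0 ⟨h1, h2, h3, h4⟩
    refine ⟨σ, hσ, h1, h2, h3, fun i hi => ?_⟩
    have := h4 i
    rwa [h0, if_pos hi] at this
  · rintro σ₀ k σ v ⟨h1, h2, h3, h4⟩
    refine ⟨h1, h2, fun r hr => ?_, h4⟩
    rw [State.set_reg, if_neg hr, h3 r hr]
  · refine polyTime_store ?_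
    rintro ⟨σ₀, k⟩ σ ⟨⟨h1, h2, h3, h4⟩, h5, -⟩
    dsimp only at *
    refine ⟨⟨?_, ?_, h3, fun i => ?_⟩, h5⟩
    · rw [← h1]; ext j; simp [State.put_arr]
    · rw [← h2]; ext j; simp [State.put_arr]
    · have h6 := h4 k
      rw [if_neg (lt_irrefl k), ← h5] at h6
      have h7 := h σ₀ σ h1 h2 h3 h6
      have h8 := h4 i
      simp only [State.put_arr, Expr.eval, h5, true_and]
      by_cases hik : i = k
      · subst hik
        rw [if_pos rfl, if_pos (Nat.lt_succ_self i)]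
        rwa [h5] at h7
      · rw [if_neg hik]
        split_ifs at h8 ⊢ <;> first | exact h8 | omega

end

end RAM

/-! ### Correctness of the algorithm -/

namespace RAM

/-- The situation of one greedy search: a non-edge `x`, `y` of a proper circular arc graph, and the
best value `best` found so far. -/
structure Task where
  n : ℕ
  G : SimpleGraph (Fin n)
  arc : IsProperCircularArcGraph G
  x : Fin n
  y : Fin n
  nonadj : Gᶜ.Adj x y
  best : ℕ

/-- The common neighbours of the non-edge. -/
def Task.common (a : Task) : Set (Fin a.n) := {w | a.G.Adj a.x w ∧ a.G.Adj a.y w}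

/-- The memory represents the task. -/
def Task.Holds (a : Task) (σ : State) : Prop :=
  Encodes a.G σ ∧ σ.reg 4 = a.x ∧ σ.reg 5 = a.y ∧ σ.reg 2 = a.best

/-- The invariant of the greedy search: to get a maximum cocktail party among the common neighbours,
add `c` non-edges to a maximum cocktail party of the alive vertices.  Register `3` also counts the
non-edge `x`, `y`. -/
def Task.Inv (a : Task) (σ : State) : Prop :=
  a.Holds σ ∧ alive a.n σ ⊆ a.common ∧ ∃ c, σ.reg 3 = c + 1 ∧
    ∀ m, IsMaxParty a.G (alive a.n σ) m → IsMaxParty a.G a.common (m + c)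

/-- The registers `1`, `7`, `8` hold the outcome of a search for a simplicial non-edge. -/
def Task.Found (a : Task) (τ : State) : Prop :=
  (τ.reg 1 ≠ 0 → ∃ u v : Fin a.n, τ.reg 7 = u + 1 ∧ τ.reg 8 = v + 1 ∧ u ∈ alive _ τ ∧
    v ∈ alive _ τ ∧ a.Gᶜ.Adj u v ∧ IsSimplicial a.G (alive _ τ) (u, v)) ∧
  (τ.reg 1 = 0 → ∀ u ∈ alive _ τ, ∀ v ∈ alive _ τ, a.Gᶜ.Adj u v →
    ¬ IsSimplicial a.G (alive _ τ) (u, v))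

theorem Task.Holds.congr {a : Task} {σ τ : State} (h : a.Holds σ) (h0 : τ.arr 0 = σ.arr 0)
    (h1 : τ.arr 1 = σ.arr 1) (hr : ∀ r, r = 0 ∨ r = 2 ∨ r = 4 ∨ r = 5 → τ.reg r = σ.reg r) :
    a.Holds τ :=
  ⟨h.1.congr (hr 0 (by simp)) h0 h1, (hr 4 (by simp)).trans h.2.1, (hr 5 (by simp)).trans h.2.2.1,
    (hr 2 (by simp)).trans h.2.2.2⟩

theorem Task.Inv.congr {a : Task} {σ τ : State} (h : a.Inv σ) (hag : Agree 7 σ τ) : a.Inv τ := by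
  obtain ⟨h1, h2, c, h3, h4⟩ := h
  have ha : alive a.n τ = alive a.n σ := by rw [alive, hag.1]; rfl
  refine ⟨h1.congr (by rw [hag.1]) (by rw [hag.1]) fun r hr => hag.2 r (by omega) (by omega), ?_, c,
    ?_, ?_⟩
  · rwa [ha]
  · rw [hag.2 3 (by norm_num) (by norm_num), h3]
  · rwa [ha]

theorem polyTime_findProg_of_task {α : Type} (f : α → Task) (P : α → State → Prop)
    (hI : ∀ a σ, P a σ → (f a).Inv σ) (hP : ∀ a σ τ, Agree 7 σ τ → P a σ → P a τ) :
    PolyTime findProg P (fun a τ => P a τ ∧ (f a).Found τ) := by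
  refine polyTime_findProg.conseq fun a σ h => ⟨(⟨_, (f a).G⟩, σ), ⟨rfl, (hI a σ h).1.1⟩, ?_⟩
  rintro τ h0 ⟨hag, hfound⟩
  exact ⟨hP a σ τ hag h, hfound⟩

theorem polyTime_greedyStepProg : PolyTime (α := Task × ℕ) greedyStepProg
    (fun a σ => (a.1.Inv σ ∧ a.1.Found σ) ∧ (Expr.var 1).eval σ ≠ 0 ∧
      (alive a.1.n σ).ncard = a.2)
    (fun a τ => (a.1.Inv τ ∧ a.1.Found τ) ∧ (alive a.1.n τ).ncard < a.2) := by
  -- after the three assignments, the ends of the non-edge are in registers `7`, `8`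
  let P : Task × ℕ → State → Prop := fun a σ => a.1.Holds σ ∧ alive a.1.n σ ⊆ a.1.common ∧
    (alive a.1.n σ).ncard = a.2 ∧ ∃ u v : Fin a.1.n, σ.reg 7 = u ∧ σ.reg 8 = v ∧
      u ∈ alive _ σ ∧ v ∈ alive _ σ ∧ a.1.Gᶜ.Adj u v ∧
      IsSimplicial a.1.G (alive _ σ) (u, v) ∧ ∃ c, σ.reg 3 = c + 2 ∧
        ∀ m, IsMaxParty a.1.G (alive a.1.n σ) m → IsMaxParty a.1.G a.1.common (m + c)
  let ψ : State → ℕ → Prop := fun σ i => σ.arr 2 i ≠ 0 ∧ σ.arr 0 (σ.arr 1 (σ.reg 7) + i) ≠ 0 ∧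
    σ.arr 0 (σ.arr 1 (σ.reg 8) + i) ≠ 0
  let Q : Task × ℕ → State → Prop := fun a σ => a.1.Inv σ ∧ (alive a.1.n σ).ncard < a.2
  have hfill := polyTime_fillProg (P := P) (ψ := ψ)
    (e := (Expr.get 2 (.var 6)).and ((adjExpr 7 6).and (adjExpr 8 6))) (by
      intro σ₀ σ h0 h1 hr h2
      simp only [Expr.eval_and_ne_zero, adjExpr, Expr.eval, ψ, h0, h1, h2,
        hr 7 (by norm_num), hr 8 (by norm_num)])
  have hfind := polyTime_findProg_of_task (α := Task × ℕ) Prod.fst Q (fun _ _ h => h.1)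
    fun a σ τ hag h => ⟨h.1.congr hag, by
      have ha : alive a.1.n τ = alive a.1.n σ := by rw [alive, hag.1]; rfl
      rw [ha]
      exact h.2⟩
  refine PolyTime.seq (polyTime_assign (Q := fun a σ => P a ((σ.set 7 (σ.reg 7 - 1)).set 8
      (σ.reg 8 - 1))) (by norm_num) ?_)
    (PolyTime.seq (polyTime_assign (Q := fun a σ => P a (σ.set 8 (σ.reg 8 - 1))) (by norm_num) ?_)
    (PolyTime.seq (polyTime_assign (Q := P) (by norm_num) ?_)
    (PolyTime.seq (hfill.conseq (Q' := Q) ?_) (hfind.conseq ?_))))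
  · rintro ⟨a, k⟩ σ ⟨⟨⟨h1, h2, c, h3, h4⟩, hf, -⟩, h5, h6⟩
    obtain ⟨u, v, hu, hv, h7, h8, h9, h10⟩ := hf h5
    refine ⟨h1.congr rfl rfl ?_, h2, h6, u, v, ?_, ?_, h7, h8, h9, h10, c, ?_, h4⟩
    · rintro r (rfl | rfl | rfl | rfl) <;> simp
    · simp [hu]
    · simp [hv]
    · simp [Expr.eval, h3]
  · intro a σ h
    simpa [Expr.eval] using h
  · intro a σ h
    exact h
  · rintro ⟨a, k⟩ σ hσ
    refine ⟨(a, k), hσ, ?_⟩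
    rintro τ - ⟨σ', ⟨h1, h2, h3, u, v, hu, hv, h7, h8, h9, h10, c, h11, h12⟩, ha0, ha1, hr, hψ⟩
    dsimp only at *
    have hal : alive a.n τ = alive a.n σ' ∩ {w | a.G.Adj u w ∧ a.G.Adj v w} := by
      ext i
      rw [mem_alive, hψ i (by rw [h1.1.1]; exact i.2)]
      simp only [ψ, hu, hv, h1.1.2]
      rfl
    refine ⟨⟨h1.congr ha0 ha1 fun r hr' => hr r (by omega), ?_, c + 1, ?_, fun m hm => ?_⟩, ?_⟩
    · rw [hal]
      exact Set.inter_subset_left.trans h2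
    · rw [hr 3 (by norm_num), h11]
    · rw [hal] at hm
      have := h12 _ (h10.isMaxParty_succ h9 h7 h8 hm)
      rwa [show m + 1 + c = m + (c + 1) by ring] at this
    · rw [← h3, hal]
      refine Set.ncard_lt_ncard ⟨Set.inter_subset_left, fun hsub => ?_⟩ (Set.toFinite _)
      exact a.G.irrefl (hsub h7).2.1
  · rintro ⟨a, k⟩ σ hσ
    refine ⟨(a, k), hσ, ?_⟩
    rintro τ - ⟨⟨h1, h2⟩, h3⟩
    exact ⟨⟨h1, h3⟩, h2⟩

/-- In a proper circular arc graph, the search gives up only when no non-edge is left. -/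
theorem Task.Found.not_adj {a : Task} {σ : State} (h : a.Found σ) (hI : a.Inv σ)
    (h1 : σ.reg 1 = 0) : ∀ u ∈ alive a.n σ, ∀ v ∈ alive a.n σ, ¬ a.Gᶜ.Adj u v := by
  intro u hu v hv huv
  obtain ⟨l, r, hx, hM⟩ := a.arc.exists_isCutModel a.x
  obtain ⟨s, hs, t, ht, hst, hsimp⟩ :=
    hM.exists_isSimplicial hx a.nonadj (U := alive a.n σ) (fun w hw => hI.2.1 hw) hu hv huv
  exact h.2 h1 s hs t ht hst hsimp

theorem polyTime_greedyProg : PolyTime greedyProg Task.Holds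
    (fun a τ => Encodes a.G τ ∧ τ.reg 4 = a.x ∧ τ.reg 5 = a.y ∧
      ∃ m, IsMaxParty a.G a.common m ∧ τ.reg 2 = max a.best (m + 1)) := by
  let ψ : State → ℕ → Prop := fun σ i => σ.arr 0 (σ.arr 1 (σ.reg 4) + i) ≠ 0 ∧
    σ.arr 0 (σ.arr 1 (σ.reg 5) + i) ≠ 0
  have hfill := polyTime_fillProg (P := Task.Holds) (ψ := ψ)
    (e := (adjExpr 4 6).and (adjExpr 5 6)) (by
      intro σ₀ σ h0 h1 hr h2
      simp only [Expr.eval_and_ne_zero, adjExpr, Expr.eval, ψ, h0, h1,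
        hr 4 (by norm_num), hr 5 (by norm_num)])
  have hloop : PolyTime (.loop (.var 1) greedyStepProg)
      (fun (a : Task) σ => a.Inv σ ∧ a.Found σ)
      (fun a τ => (a.Inv τ ∧ a.Found τ) ∧ (Expr.var 1).eval τ = 0) := by
    refine PolyTime.loop (fun a σ => (alive a.n σ).ncard) ?_ polyTime_greedyStepProg
    intro a σ h
    rw [h.1.1.1.1]
    exact (Set.ncard_le_card _).trans (by simp)
  have hcond : ∀ (a : Task) σ, (a.Inv σ ∧ a.Found σ) ∧ (Expr.var 1).eval σ = 0 →
      a.Holds σ ∧ ∃ m, IsMaxParty a.G a.common m ∧ σ.reg 3 = m + 1 := by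
    rintro a σ ⟨⟨hI, hF⟩, h1⟩
    obtain ⟨c, h3, h4⟩ := hI.2.2
    have := h4 0 (isMaxParty_zero (hF.not_adj hI h1))
    exact ⟨hI.1, c, by simpa using this, h3⟩
  refine PolyTime.seq (hfill.conseq (Q' := fun a τ => a.Holds τ ∧ alive a.n τ = a.common) ?_)
    (PolyTime.seq (polyTime_assign (Q := Task.Inv) (by norm_num) ?_)
    (PolyTime.seq (polyTime_findProg_of_task id Task.Inv (fun _ _ h => h)
      fun _ _ _ hag h => h.congr hag)
    (PolyTime.seq hloop (PolyTime.branch (polyTime_assign (by norm_num) ?_)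
      (polyTime_skip ?_)))))
  · rintro a σ hσ
    refine ⟨a, hσ, ?_⟩
    rintro τ - ⟨σ', h1, ha0, ha1, hr, hψ⟩
    refine ⟨h1.congr ha0 ha1 fun r hr' => hr r (by omega), ?_⟩
    ext i
    rw [mem_alive, hψ i (by rw [h1.1.1]; exact i.2)]
    simp only [ψ, h1.2.1, h1.2.2.1, h1.1.2]
    rfl
  · rintro a σ ⟨h1, h2⟩
    have ha : alive a.n (σ.set 3 ((Expr.num 1).eval σ)) = a.common := h2
    refine ⟨h1.congr rfl rfl ?_, ?_, 0, ?_, fun m hm => ?_⟩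
    · rintro r (rfl | rfl | rfl | rfl) <;> simp
    · rw [ha]
    · simp [Expr.eval]
    · rwa [ha] at hm
  · rintro a σ ⟨h, hlt⟩
    obtain ⟨h1, m, hm, h3⟩ := hcond a σ h
    simp only [Expr.eval] at hlt
    have h2 := h1.2.2.2
    refine ⟨h1.1.congr (by simp) rfl rfl, by simpa using h1.2.1, by simpa using h1.2.2.1, m, hm, ?_⟩
    simp only [State.set_reg, if_true, Expr.eval]
    omega
  · rintro a σ ⟨h, hlt⟩
    obtain ⟨h1, m, hm, h3⟩ := hcond a σ h
    simp only [Expr.eval] at hlt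
    have h2 := h1.2.2.2
    refine ⟨h1.1, h1.2.1, h1.2.2.1, m, hm, ?_⟩
    omega

/-- A proper circular arc graph on the vertices `0, …, n - 1`. -/
structure Instance where
  n : ℕ
  G : SimpleGraph (Fin n)
  arc : IsProperCircularArcGraph G

/-- Register `2` holds the size of some cocktail party, and it is at least the size of every
cocktail party with a non-edge `x`, `y` such that `S x y`. -/
def Instance.Best (a : Instance) (S : Fin a.n → Fin a.n → Prop) (σ : State) : Prop :=
  Encodes a.G σ ∧ (∃ L, IsCocktailParty a.G Set.univ L ∧ L.length = σ.reg 2) ∧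
    ∀ x y, S x y → ∀ L, IsCocktailParty a.G Set.univ ((x, y) :: L) → L.length + 1 ≤ σ.reg 2

theorem Instance.Best.congr {a : Instance} {S : Fin a.n → Fin a.n → Prop} {σ τ : State}
    (h : a.Best S σ) (h0 : τ.arr = σ.arr) (hr : ∀ r, r = 0 ∨ r = 2 → τ.reg r = σ.reg r) :
    a.Best S τ := by
  unfold Instance.Best
  rw [hr 2 (by simp)]
  exact ⟨h.1.congr (hr 0 (by simp)) (by rw [h0]) (by rw [h0]), h.2⟩

theorem Instance.Best.mono {a : Instance} {S S' : Fin a.n → Fin a.n → Prop} {σ : State}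
    (h : a.Best S σ) (hS : ∀ x y, S' x y → S x y) : a.Best S' σ :=
  ⟨h.1, h.2.1, fun x y hxy => h.2.2 x y (hS x y hxy)⟩

/-- Processing one more pair of vertices. -/
theorem polyTime_branch_greedyProg :
    PolyTime (α := (Instance × ℕ) × ℕ) (.branch (nonAdjExpr 4 5) greedyProg .skip)
    (fun a σ => a.1.1.Best (fun x y => (x : ℕ) < a.1.2 ∨ ((x : ℕ) = a.1.2 ∧ (y : ℕ) < a.2)) σ ∧
      (σ.reg 4 = a.1.2 ∧ a.1.2 < a.1.1.n) ∧ σ.reg 5 = a.2 ∧ a.2 < a.1.1.n)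
    (fun a σ => a.1.1.Best
        (fun x y => (x : ℕ) < a.1.2 ∨ ((x : ℕ) = a.1.2 ∧ (y : ℕ) < a.2 + 1)) σ ∧
      σ.reg 4 = a.1.2 ∧ σ.reg 5 = a.2) := by
  refine PolyTime.branch (polyTime_greedyProg.conseq ?_) (polyTime_skip ?_)
  · rintro ⟨⟨a, i⟩, j⟩ σ ⟨⟨hB, ⟨h4, hi⟩, h5, hj⟩, hadj⟩
    dsimp only at *
    have hxy := (hB.1.nonAdj_iff ⟨i, hi⟩ ⟨j, hj⟩ h4 h5).1 hadj
    refine ⟨⟨a.n, a.G, a.arc, ⟨i, hi⟩, ⟨j, hj⟩, hxy, σ.reg 2⟩, ⟨hB.1, h4, h5, rfl⟩, ?_⟩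
    rintro τ - ⟨hE, h4', h5', m, hm, h2⟩
    dsimp only [Task.common] at *
    refine ⟨⟨hE, ?_, ?_⟩, h4', h5'⟩
    · rw [h2]
      rcases max_choice (σ.reg 2) (m + 1) with h | h
      · rw [h]
        exact hB.2.1
      · rw [h]
        obtain ⟨L, hL, hLm⟩ := hm.1
        refine ⟨(⟨i, hi⟩, ⟨j, hj⟩) :: L, isCocktailParty_cons.2 ⟨⟨hxy, trivial, trivial⟩, ?_⟩, ?_⟩
        · rwa [Set.univ_inter]
        · simp [hLm]
    · intro x y hS L hL
      by_cases hnew : x = ⟨i, hi⟩ ∧ y = ⟨j, hj⟩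
      · obtain ⟨rfl, rfl⟩ := hnew
        have h := (isCocktailParty_cons.1 hL).2
        rw [Set.univ_inter] at h
        have := hm.2 L h
        omega
      · have := hB.2.2 x y (by
          rw [Fin.ext_iff, Fin.ext_iff] at hnew
          simp only at hnew
          omega) L hL
        omega
  · rintro ⟨⟨a, i⟩, j⟩ σ ⟨⟨hB, ⟨h4, hi⟩, h5, hj⟩, hadj⟩
    dsimp only at *
    refine ⟨⟨hB.1, hB.2.1, ?_⟩, h4, h5⟩
    intro x y hS L hL
    by_cases hnew : x = ⟨i, hi⟩ ∧ y = ⟨j, hj⟩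
    · obtain ⟨rfl, rfl⟩ := hnew
      have h := (isCocktailParty_cons.1 hL).1.1
      rw [← hB.1.nonAdj_iff ⟨i, hi⟩ ⟨j, hj⟩ h4 h5] at h
      exact absurd hadj h
    · refine hB.2.2 x y ?_ L hL
      rw [Fin.ext_iff, Fin.ext_iff] at hnew
      simp only at hnew
      omega

theorem polyTime_offsetProg :
    PolyTime offsetProg (fun (a : Instance) σ => σ = inputState a.G)
      (fun a τ => a.Best (fun _ _ => False) τ) := by
  have key := PolyTime.forProg (α := Instance) (x := 6)
    (p := .store 1 (.add (.var 6) (.num 1)) (.add (.get 1 (.var 6)) (.var 0))) (by norm_num)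
    (fun a k σ => σ.arr 0 = (inputState a.G).arr 0 ∧ σ.reg 0 = a.n ∧ σ.reg 2 = 0 ∧
      ∀ i ≤ k, σ.arr 1 i = i * a.n) ?_ ?_
  · refine key.conseq fun a σ hσ => ⟨a, ?_, ?_⟩
    · subst hσ
      refine ⟨rfl, by simp [inputState], by simp [inputState], ?_⟩
      simp [inputState]
    · rintro τ - ⟨h1, h2, h3, h4⟩
      refine ⟨⟨h2, fun i j => ?_⟩, ⟨[], isCocktailParty_nil _, h3.symm⟩, fun _ _ h => h.elim⟩
      rw [h4 i (by rw [h2]; exact i.2.le), h1]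
      simp only [inputState, true_and, ne_eq, ite_eq_right_iff, one_ne_zero, imp_false, not_not]
      constructor
      · rintro ⟨i', j', h5, h6⟩
        have hj : (i : ℕ) * a.n + j = i' * a.n + j' := h5
        have e1 : (i : ℕ) = i' := by
          have := congrArg (· / a.n) hj
          simpa [Nat.add_div_of_dvd_right, Nat.mul_div_cancel _ (i.pos), Nat.div_eq_of_lt] using this
        have e2 : (j : ℕ) = j' := by
          rw [e1] at hj
          omega
        rwa [Fin.ext e1, Fin.ext e2]
      · intro h
        exact ⟨i, j, rfl, h⟩
  · rintro a k σ v ⟨h1, h2, h3, h4⟩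
    exact ⟨h1, by simpa using h2, by simpa using h3, h4⟩
  · refine polyTime_store ?_
    rintro ⟨a, k⟩ σ ⟨⟨h1, h2, h3, h4⟩, h5, -⟩
    dsimp only at *
    refine ⟨⟨?_, h2, h3, fun i hi => ?_⟩, h5⟩
    · rw [← h1]; ext j; simp [State.put_arr]
    · simp only [State.put_arr, Expr.eval, h5, h2, h4 k le_rfl, true_and]
      by_cases hik : i = k + 1
      · rw [if_pos hik, hik, Nat.succ_mul]
      · rw [if_neg hik]
        exact h4 i (by omega)

/-- The program leaves the size of a largest cocktail party in register `2`. -/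
theorem polyTime_partyProg : PolyTime partyProg (fun (a : Instance) σ => σ = inputState a.G)
    (fun a τ => IsMaxParty a.G Set.univ (τ.reg 2)) := by
  have hinner := PolyTime.forProg (α := Instance × ℕ) (x := 5)
    (p := .branch (nonAdjExpr 4 5) greedyProg .skip) (by norm_num)
    (fun a j σ => a.1.Best (fun x y => (x : ℕ) < a.2 ∨ ((x : ℕ) = a.2 ∧ (y : ℕ) < j)) σ ∧
      (σ.reg 4 = a.2 ∧ a.2 < a.1.n))
    (fun a j σ v h => ⟨h.1.congr rfl (by rintro r (rfl | rfl) <;> simp), by simpa using h.2⟩)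
    (polyTime_branch_greedyProg.conseq (by
      rintro ⟨⟨a, i⟩, j⟩ σ ⟨⟨h1, h2⟩, h3, h4⟩
      have h0 := h1.1.1
      dsimp only at *
      refine ⟨((a, i), j), ⟨h1, h2, h3, h0 ▸ h4⟩, ?_⟩
      rintro τ - ⟨h5, h6, h7⟩
      exact ⟨⟨h5, h6, h2.2⟩, h7⟩))
  have houter := PolyTime.forProg (α := Instance) (x := 4)
    (p := forProg 5 (.branch (nonAdjExpr 4 5) greedyProg .skip)) (by norm_num)
    (fun a i σ => a.Best (fun x _ => (x : ℕ) < i) σ)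
    (fun a i σ v h => h.congr rfl (by rintro r (rfl | rfl) <;> simp))
    (hinner.conseq (by
      rintro ⟨a, i⟩ σ ⟨h1, h2, h3⟩
      have h0 := h1.1.1
      dsimp only at *
      refine ⟨(a, i), ⟨h1.mono (by simp), h2, h0 ▸ h3⟩, ?_⟩
      rintro τ h0' ⟨h4, h5, -⟩
      refine ⟨h4.mono fun x y hx => ?_, h5⟩
      have hy := y.2
      have hn := h4.1.1
      dsimp only at *
      omega))
  refine PolyTime.seq polyTime_offsetProg (houter.conseq ?_)
  intro a σ h
  refine ⟨a, h.mono (by simp), ?_⟩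
  rintro τ - h'
  refine ⟨h'.2.1, fun L hL => ?_⟩
  rcases L with _ | ⟨⟨x, y⟩, L⟩
  · simp
  · exact h'.2.2 x y (by rw [h'.1.1]; exact x.2) L hL

end RAM

theorem IsProperCircularArcGraph.boxicity_le {V : Type*} [Finite V] {G : SimpleGraph V}
    (hG : IsProperCircularArcGraph G) (k : ℕ)
    (hk : ∀ L, IsCocktailParty G Set.univ L → L.length ≤ k) : boxicity G ≤ k + 2 := by
  refine Nat.sInf_le ?_
  rcases isEmpty_or_nonempty V with hV | ⟨⟨x⟩⟩
  · exact ⟨fun _ => ⊥, fun _ => ⟨isEmptyElim, isEmptyElim, isEmptyElim, isEmptyElim⟩, isEmptyElim⟩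
  · obtain ⟨l, r, -, hM⟩ := hG.exists_isCutModel x
    exact hM.hasBoxRep k hk

/-- The boxicity of proper circular arc graphs can be approximated within an additive `2` in
polynomial time: one program, given the adjacency matrix of any proper circular arc graph `G` on
`n` vertices, halts after a number of steps polynomial in `n`, with a number `b` in register `0`
such that `boxicity G ≤ b ≤ boxicity G + 2`. -/
theorem mainTheorem3 :
    ∃ (p : RAM.Prog) (T : Polynomial ℕ),
      ∀ (n : ℕ) (G : SimpleGraph (Fin n)), IsProperCircularArcGraph G →
        ∃ (k : ℕ) (τ : RAM.State),
          RAM.Runs p (RAM.inputState G) k τ ∧ k ≤ T.eval n ∧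
          boxicity G ≤ τ.reg 0 ∧ τ.reg 0 ≤ boxicity G + 2 := by
  obtain ⟨T, hT⟩ := RAM.polyTime_partyProg
  refine ⟨.seq RAM.partyProg (.assign 0 (.add (.var 2) (.num 2))), T + 4, fun n G hG => ?_⟩
  obtain ⟨k, τ, h1, h2, -, h4⟩ := hT ⟨n, G, hG⟩ _ rfl
  dsimp only at h4
  refine ⟨_, _, h1.seq (.assign τ 0 _), ?_, ?_, ?_⟩
  · simpa [RAM.Expr.cost, RAM.inputState] using h2
  · simpa [RAM.Expr.eval] using hG.boxicity_le _ h4.2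
  · obtain ⟨L, hL, hlen⟩ := h4.1
    simpa [RAM.Expr.eval, ← hlen] using hL.length_le_boxicity
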